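/- Fix complex numbers $p,q$ with $|p|<1$, $0<|q|<1$, and for $z\in\mathbb{C}\setminus\{0\}$ and $k\ge 0$ put $$\theta(z)=\prod_{j=0}^\infty(1-p^jz)\left(1-\frac{p^{j+1}}{z}\right),\qquad (z)_k=\prod_{j=0}^{k-1}\theta(zq^j),\qquad (z_1,\dots,z_m)_k=(z_1)_k\cdots(z_m)_k.$$ Let $n,N$ be non-negative integers with $n\le N+1$, and let $a,b,c,d,e$ be non-zero complex numbers such that $$bcde=q^{N+3-2n}a^2 .$$ Assume that no denominator vanishes, that is, $\theta(a)\neq 0$ and $(q,aq/b,aq/c,aq/d,aq/e,aq^{N+1})_N\neq 0$. Then $$\sum_{0\leq x_1<x_2<\dots<x_n\leq N}\ \prod_{1\leq j<k\leq n}\big(q^{x_j}\theta(q^{x_k-x_j})\theta(aq^{x_j+x_k})\big)^2 \prod_{j=1}^n\left(\frac{\theta(aq^{2x_j})}{\theta(a)} \frac{(a,b,c,d,e,q^{-N})_{x_j}}{(q,aq/b,aq/c,aq/d,aq/e,aq^{N+1})_{x_j}}\,q^{x_j}\right)$$ $$=b^{n(N+1-n)}\,q^{\frac13 n(n-1)(3N+1-2n)+\binom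 n2}\,(aq)_N^n \prod_{j=1}^n\frac{(q,b,c,d,e,q^{-N})_{j-1}\,(aq^{2-j}/bc,\,aq^{2-j}/bd,\,aq^{2-j}/be)_{N+1-n}}{(aq/b,aq/c,aq/d,aq/e)_{N+1-j}} .$$ -/

import Mathlib

/-- The multiplicative theta function of nome `p`,
`θ(z) = ∏_{j ≥ 0} (1 - p ^ j z) (1 - p ^ (j+1) / z)`. -/
noncomputable def ellTheta (p z : ℂ) : ℂ :=
  ∏' j : ℕ, (1 - p ^ j * z) * (1 - p ^ (j + 1) / z)

/-- The product defining `ellTheta` converges whenever `|p| < 1`. -/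
theorem ellTheta_multipliable {p : ℂ} (hp : ‖p‖ < 1) (z : ℂ) :
    Multipliable fun j : ℕ => (1 - p ^ j * z) * (1 - p ^ (j + 1) / z) := by
  have hs : Summable fun j : ℕ => ‖p‖ ^ j := summable_geometric_of_lt_one (norm_nonneg p) hp
  have h1 : Multipliable fun j : ℕ => 1 + -(p ^ j * z) := by
    refine multipliable_one_add_of_summable ?_
    simpa [norm_mul, norm_pow] using hs.mul_right ‖z‖
  have h2 : Multipliable fun j : ℕ => 1 + -(p ^ (j + 1) / z) := by
    refine multipliable_one_add_of_summable ?_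
    simpa [norm_div, norm_pow, pow_succ, div_eq_mul_inv, mul_assoc] using
      hs.mul_right (‖p‖ * ‖z‖⁻¹)
  simpa [sub_eq_add_neg] using h1.mul h2

/-- The elliptic shifted factorial `(z)_k = ∏_{j=0}^{k-1} θ(z q ^ j)`. -/
noncomputable def ellPoch (p q z : ℂ) (k : ℕ) : ℂ :=
  ∏ j ∈ Finset.range k, ellTheta p (z * q ^ j)

/-- The shorthand `(z₁, …, zₘ)_k = (z₁)_k ⋯ (zₘ)_k`. -/
noncomputable def ellPochs (p q : ℂ) (zs : List ℂ) (k : ℕ) : ℂ :=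
  (zs.map fun z => ellPoch p q z k).prod

/-- The index set `0 ≤ x₁ < x₂ < ⋯ < xₙ ≤ N`. -/
def increasingTuples (n N : ℕ) : Finset (Fin n → Fin (N + 1)) :=
  Finset.univ.filter fun x => ∀ j k, j < k → x j < x k

/-- The squared theta-Vandermonde
`∏_{j < k} (q ^ x_j θ(q ^ (x_k - x_j)) θ(a q ^ (x_j + x_k))) ^ 2`. -/
noncomputable def thetaVandermondeSq (p q a : ℂ) {n N : ℕ} (x : Fin n → Fin (N + 1)) : ℂ :=
  ∏ j : Fin n, ∏ k ∈ Finset.Ioi j,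
    (q ^ (x j : ℕ) * ellTheta p (q ^ ((x k : ℤ) - (x j : ℤ))) *
      ellTheta p (a * q ^ ((x j : ℕ) + (x k : ℕ)))) ^ 2

/-- The very-well-poised weight
`θ(a q ^ (2y)) / θ(a) * (a,b,c,d,e,q ^ (-N))_y / (q,aq/b,aq/c,aq/d,aq/e,a q ^ (N+1))_y * q ^ y`. -/
noncomputable def vwpWeight (p q a b c d e : ℂ) (N y : ℕ) : ℂ :=
  ellTheta p (a * q ^ (2 * y)) / ellTheta p a *
    (ellPochs p q [a, b, c, d, e, q ^ (-(N : ℤ))] y /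
      ellPochs p q [q, a * q / b, a * q / c, a * q / d, a * q / e, a * q ^ (N + 1)] y) *
    q ^ y

/-- The division by `3` in the exponent of `q` in the product formula is exact. -/
theorem three_dvd_selbergExponent (n N : ℕ) :
    (3 : ℤ) ∣ (n : ℤ) * (n - 1) * (3 * N + 1 - 2 * n) := by
  have h : ((n : ℤ) * (n - 1) * (3 * N + 1 - 2 * n)) % 3 = 0 := by
    have h3 : (n : ℤ) % 3 = 0 ∨ (n : ℤ) % 3 = 1 ∨ (n : ℤ) % 3 = 2 := by omega
    rcases h3 with h | h | h <;> simp [Int.mul_emod, Int.sub_emod, Int.add_emod, h]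
  exact Int.dvd_of_emod_eq_zero h

/-! Put `θ(e^u) = e^(u/2) s(u)`. Then `s` is odd and satisfies the three-term Weierstrass addition
formula, and these two properties, with continuity and countability of the zeros, are all that the
summation needs. The addition formula says that the bracket `⟨x, y⟩ = s (x + y) s (x - y)` is an
area form `f x * g y - f y * g x`, so a product of `n - 1` brackets in `x` is a binary form of
degree `n - 1` in `(f x, g x)`. Determinants of such products therefore reduce to a homogeneous
Vandermonde determinant, that is, to a product of brackets (`det_prod_bracket`).

At the points `α/2 + x_i η` that product is, up to sign, the unsquared theta-Vandermonde. One factor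
of the square is written as a determinant built from `β, γ`, the other as one built from `δ, ε`.
Cauchy–Binet turns the sum over increasing tuples into a single `n × n` determinant whose entries
are one-variable sums. The brackets in an entry only shift the parameters by multiples of `η`
(`sigmaPoch_shift_ratio`), and the shifts total `2(n - 1)η`, which is exactly what makes each entry
a Frenkel–Turaev sum. Up to row and column factors the evaluated entries are again products of `n -
1` brackets, so the same determinant formula finishes the computation (`sigma_selberg_generic`).

The Frenkel–Turaev sum follows by induction on `N` from a contiguous relation; both the relation and
the inductive step are instances of the addition formula. The argument divides by quantities that
vanish only for special parameters, and these are recovered by continuity (`sigma_selberg`).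

The addition formula itself comes from the Jacobi triple product: the double series of `θ(xy)
θ(x/y)`, split by parity, shows that the bracket has rank at most two, and an antisymmetric kernel
of rank at most two has vanishing 4 × 4 Pfaffians. -/

/-! ### Weierstrass sigma functions and additive shifted factorials. -/

/-- An odd function satisfying the Weierstrass addition formula. -/
structure IsWeierstrassSigma (s : ℂ → ℂ) : Prop where
  odd : ∀ x, s (-x) = -s x
  add : ∀ x y u v, s (x + y) * s (x - y) * (s (u + v) * s (u - v)) =
    s (x + v) * s (x - v) * (s (u + y) * s (u - y)) +
      s (y + v) * s (y - v) * (s (x + u) * s (x - u))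

/-- The additive shifted factorial `∏_{j < k} s (u + j η)`. -/
def sigmaPoch (s : ℂ → ℂ) (η u : ℂ) (k : ℕ) : ℂ :=
  ∏ j ∈ Finset.range k, s (u + j * η)

section SigmaPoch

variable (s : ℂ → ℂ) (η u : ℂ)

@[simp] theorem sigmaPoch_zero : sigmaPoch s η u 0 = 1 := by simp [sigmaPoch]

theorem sigmaPoch_succ (k : ℕ) : sigmaPoch s η u (k + 1) = sigmaPoch s η u k * s (u + k * η) := by
  simp [sigmaPoch, Finset.prod_range_succ]

theorem sigmaPoch_add (k l : ℕ) :
    sigmaPoch s η u (k + l) = sigmaPoch s η u k * sigmaPoch s η (u + k * η) l := by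
  simp only [sigmaPoch, Finset.prod_range_add]
  congr 1
  refine Finset.prod_congr rfl fun j _ => ?_
  congr 1
  push_cast
  ring

theorem sigmaPoch_succ' (k : ℕ) : sigmaPoch s η u (k + 1) = s u * sigmaPoch s η (u + η) k := by
  rw [add_comm k 1, sigmaPoch_add]
  simp [sigmaPoch]

theorem sigmaPoch_ne_zero {s : ℂ → ℂ} {η u : ℂ} {k : ℕ} (h : ∀ j < k, s (u + j * η) ≠ 0) :
    sigmaPoch s η u k ≠ 0 :=
  Finset.prod_ne_zero_iff.2 fun j hj => h j (Finset.mem_range.1 hj)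

theorem sigmaPoch_ne_zero_of_le {s : ℂ → ℂ} {η u : ℂ} {k l : ℕ} (h : sigmaPoch s η u l ≠ 0)
    (hkl : k ≤ l) : sigmaPoch s η u k ≠ 0 := by
  obtain ⟨m, rfl⟩ := Nat.exists_eq_add_of_le hkl
  rw [sigmaPoch_add] at h
  exact left_ne_zero_of_mul h

theorem sigmaPoch_reflect {s : ℂ → ℂ} (hs : ∀ x, s (-x) = -s x) (η u : ℂ) (k : ℕ) :
    sigmaPoch s η u k = (-1) ^ k * sigmaPoch s η (-u - k * η + η) k := by
  have h : (-1 : ℂ) ^ k = ∏ _j ∈ Finset.range k, (-1 : ℂ) := by simp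
  rw [h, sigmaPoch, sigmaPoch, ← Finset.prod_mul_distrib, ← Finset.prod_range_reflect]
  refine Finset.prod_congr rfl fun j hj => ?_
  have hj := Finset.mem_range.1 hj
  rw [neg_one_mul, ← hs]
  congr 1
  rw [Nat.cast_sub (by omega), Nat.cast_sub (by omega)]
  push_cast
  ring

end SigmaPoch

/-! ### The Frenkel–Turaev summation. -/

/-- The very-well-poised weight in additive notation. -/
noncomputable def sigmaWeight (s : ℂ → ℂ) (η α β γ δ ε ν : ℂ) (k : ℕ) : ℂ :=
  s (α + 2 * k * η) / s α *
    ((sigmaPoch s η α k * sigmaPoch s η β k * sigmaPoch s η γ k * sigmaPoch s η δ k *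
        sigmaPoch s η ε k * sigmaPoch s η ν k) /
      (sigmaPoch s η η k * sigmaPoch s η (α + η - β) k * sigmaPoch s η (α + η - γ) k *
        sigmaPoch s η (α + η - δ) k * sigmaPoch s η (α + η - ε) k *
        sigmaPoch s η (α + η - ν) k))

theorem sigmaWeight_zero {s : ℂ → ℂ} {α : ℂ} (h : s α ≠ 0) (η β γ δ ε ν : ℂ) :
    sigmaWeight s η α β γ δ ε ν 0 = 1 := by
  simp [sigmaWeight, h]

/-- Isolates the cancellation in the contiguous relation, so that its only content is the three-term
identity `key`. -/
theorem contiguous_aux {K : Type*} [Field K] {a0 a1 am X Y h W e0 e1 n0 n1 f0 f1 fl r1 r2 rl κ : K}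
    (ham : am ≠ 0) (hh : h ≠ 0) (hW : W ≠ 0)
    (hf0 : f0 ≠ 0) (hf1 : f1 ≠ 0) (hfl : fl ≠ 0)
    (hr1 : r1 ≠ 0) (hr2 : r2 ≠ 0) (hrl : rl ≠ 0)
    (key : e1 * n1 * (fl * r1) - e0 * n0 * (f0 * rl) = -(κ * (am * h))) :
    (a0 * a1 * X / am * Y * (e1 * n1)) / (h * W * (f0 * (f1 / fl)) * r2) -
      (a0 * a1 * X / am * Y * (e0 * n0)) / (h * W * f1 * (r1 * (r2 / rl))) =
      -(κ * (a0 * a1 * X * Y) / (f0 * f1 * r1 * r2 * W)) := by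
  have h1 : (a0 * a1 * X / am * Y * (e1 * n1)) / (h * W * (f0 * (f1 / fl)) * r2) =
      (a0 * a1 * X * Y) / (am * h * W * f0 * f1 * r1 * r2) * (e1 * n1 * (fl * r1)) := by
    field_simp
  have h2 : (a0 * a1 * X / am * Y * (e0 * n0)) / (h * W * f1 * (r1 * (r2 / rl))) =
      (a0 * a1 * X * Y) / (am * h * W * f0 * f1 * r1 * r2) * (e0 * n0 * (f0 * rl)) := by
    field_simp
  rw [h1, h2, ← mul_sub, key]
  field_simp

theorem sigmaPoch_ne_zero_of_int {s : ℂ → ℂ} {η u v : ℂ} (h : ∀ k : ℤ, s (u + k * η) ≠ 0) (m : ℤ)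
    (hv : v = u + m * η) (k : ℕ) : sigmaPoch s η v k ≠ 0 := by
  refine sigmaPoch_ne_zero fun j _ => ?_
  have := h (m + j)
  rw [hv]
  convert this using 2
  push_cast
  ring

theorem sigma_ne_zero_of_int {s : ℂ → ℂ} {η u v : ℂ} (h : ∀ k : ℤ, s (u + k * η) ≠ 0) (m : ℤ)
    (hv : v = u + m * η) : s v ≠ 0 :=
  hv ▸ h m

/-- The two weights on the left differ only in boundary factors of the shifted factorials involving
`ε` and `-N * η`. The difference of those factors is one instance of the addition formula, and the
common part is a weight with `α` moved by `2η` and the other parameters by `η`. This drives the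
induction on `N`. -/
theorem sigmaWeight_contiguous {s : ℂ → ℂ} (hs : IsWeierstrassSigma s) {η α β γ δ ε : ℂ}
    (N l : ℕ) (hα : ∀ k : ℤ, s (α + k * η) ≠ 0) (hβ : ∀ k : ℤ, s (α - β + k * η) ≠ 0)
    (hγ : ∀ k : ℤ, s (α - γ + k * η) ≠ 0) (hδ : ∀ k : ℤ, s (α - δ + k * η) ≠ 0)
    (hε : ∀ k : ℤ, s (α - ε + k * η) ≠ 0) (hη : sigmaPoch s η η (l + 1) ≠ 0) :
    sigmaWeight s η α β γ δ (ε + η) (-(N + 1) * η) (l + 1) -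
        sigmaWeight s η α β γ δ ε (-N * η) (l + 1) =
      -(s (ε + (N + 1) * η) * s (α - ε + (N + 1) * η) *
          (s (α + η) * s (α + 2 * η) * s β * s γ * s δ) /
          (s (α - ε) * s (α + η - ε) * s (α + (N + 1) * η) * s (α + (N + 2) * η) *
            (s (α + η - β) * s (α + η - γ) * s (α + η - δ)))) *
        sigmaWeight s η (α + 2 * η) (β + η) (γ + η) (δ + η) (ε + η) (-N * η) l := by
  have cong : ∀ {u v : ℂ} (k : ℕ), u = v → sigmaPoch s η u k = sigmaPoch s η v k :=
    fun k h => by rw [h]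
  have h0 : s α ≠ 0 := sigma_ne_zero_of_int hα 0 (by simp)
  have h2 : s (α + 2 * η) ≠ 0 := sigma_ne_zero_of_int hα 2 (by push_cast; ring)
  have ham : s (α + (l + 1) * η) ≠ 0 := sigma_ne_zero_of_int hα (l + 1) (by push_cast; ring)
  have hf0 : s (α - ε) ≠ 0 := sigma_ne_zero_of_int hε 0 (by simp)
  have hf1 : s (α + η - ε) ≠ 0 := sigma_ne_zero_of_int hε 1 (by push_cast; ring)
  have hfl : s (α + η - ε + l * η) ≠ 0 := sigma_ne_zero_of_int hε (1 + l) (by push_cast; ring)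
  have hr1 : s (α + (N + 1) * η) ≠ 0 := sigma_ne_zero_of_int hα (N + 1) (by push_cast; ring)
  have hr2 : s (α + (N + 2) * η) ≠ 0 := sigma_ne_zero_of_int hα (N + 2) (by push_cast; ring)
  have hrl : s (α + (N + 2) * η + l * η) ≠ 0 :=
    sigma_ne_zero_of_int hα (N + 2 + l) (by push_cast; ring)
  have hb : s (α + η - β) ≠ 0 := sigma_ne_zero_of_int hβ 1 (by push_cast; ring)
  have hc : s (α + η - γ) ≠ 0 := sigma_ne_zero_of_int hγ 1 (by push_cast; ring)
  have hd : s (α + η - δ) ≠ 0 := sigma_ne_zero_of_int hδ 1 (by push_cast; ring)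
  have hB := sigmaPoch_ne_zero_of_int hβ (v := α + 2 * η - β) 2 (by push_cast; ring) l
  have hC := sigmaPoch_ne_zero_of_int hγ (v := α + 2 * η - γ) 2 (by push_cast; ring) l
  have hD := sigmaPoch_ne_zero_of_int hδ (v := α + 2 * η - δ) 2 (by push_cast; ring) l
  have hF := sigmaPoch_ne_zero_of_int hε (v := α + 2 * η - ε) 2 (by push_cast; ring) l
  have hR := sigmaPoch_ne_zero_of_int hα (v := α + (N + 3) * η) (N + 3) (by push_cast; ring) l
  rw [sigmaPoch_succ] at hη
  have hH := left_ne_zero_of_mul hη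
  have hh := right_ne_zero_of_mul hη
  have eα : sigmaPoch s η α (l + 1) =
      s α * s (α + η) * sigmaPoch s η (α + 2 * η) l / s (α + (l + 1) * η) := by
    rw [eq_div_iff ham]
    have := sigmaPoch_succ s η α (l + 1)
    push_cast at this
    rw [← this, sigmaPoch_succ', sigmaPoch_succ', cong l (show α + η + η = α + 2 * η by ring)]
    ring
  have eF0 : sigmaPoch s η (α + η - ε) l =
      s (α + η - ε) * sigmaPoch s η (α + 2 * η - ε) l / s (α + η - ε + l * η) := by
    rw [eq_div_iff hfl, ← sigmaPoch_succ, sigmaPoch_succ',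
      cong l (show α + η - ε + η = α + 2 * η - ε by ring)]
  have eR0 : sigmaPoch s η (α + (N + 2) * η) l =
      s (α + (N + 2) * η) * sigmaPoch s η (α + (N + 3) * η) l / s (α + (N + 2) * η + l * η) := by
    rw [eq_div_iff hrl, ← sigmaPoch_succ, sigmaPoch_succ',
      cong l (show α + (N + 2) * η + η = α + (N + 3) * η by ring)]
  have key : s (ε + η + l * η) * s (-(N + 1) * η) *
        (s (α + η - ε + l * η) * s (α + (N + 1) * η)) -
      s ε * s (-N * η + l * η) * (s (α - ε) * s (α + (N + 2) * η + l * η)) =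
      -(s (ε + (N + 1) * η) * s (α - ε + (N + 1) * η) *
        (s (α + (l + 1) * η) * s (η + l * η))) := by
    -- The six brackets of these four points are exactly the twelve values of `s` in `key`.
    have := hs.add (α / 2 + (l + 1) * η) (α / 2 + (N + 1) * η) (α / 2) (ε - α / 2)
    rw [show α / 2 + (l + 1) * η + (α / 2 + (N + 1) * η) = α + (N + 2) * η + l * η by ring,
      show α / 2 + (l + 1) * η - (α / 2 + (N + 1) * η) = -N * η + l * η by ring,
      show α / 2 + (ε - α / 2) = ε by ring, show α / 2 - (ε - α / 2) = α - ε by ring,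
      show α / 2 + (l + 1) * η + (ε - α / 2) = ε + η + l * η by ring,
      show α / 2 + (l + 1) * η - (ε - α / 2) = α + η - ε + l * η by ring,
      show α / 2 + (α / 2 + (N + 1) * η) = α + (N + 1) * η by ring,
      show α / 2 - (α / 2 + (N + 1) * η) = -(N + 1) * η by ring,
      show α / 2 + (N + 1) * η + (ε - α / 2) = ε + (N + 1) * η by ring,
      show α / 2 + (N + 1) * η - (ε - α / 2) = α - ε + (N + 1) * η by ring,
      show α / 2 + (l + 1) * η + α / 2 = α + (l + 1) * η by ring,
      show α / 2 + (l + 1) * η - α / 2 = η + l * η by ring] at this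
    linear_combination -this
  have main := contiguous_aux (a0 := s α) (a1 := s (α + η)) (X := sigmaPoch s η (α + 2 * η) l)
    (Y := s β * sigmaPoch s η (β + η) l * (s γ * sigmaPoch s η (γ + η) l) *
      (s δ * sigmaPoch s η (δ + η) l) * sigmaPoch s η (ε + η) l * sigmaPoch s η (-N * η) l)
    (W := sigmaPoch s η η l * (s (α + η - β) * sigmaPoch s η (α + 2 * η - β) l) *
      (s (α + η - γ) * sigmaPoch s η (α + 2 * η - γ) l) *
      (s (α + η - δ) * sigmaPoch s η (α + 2 * η - δ) l) * sigmaPoch s η (α + 2 * η - ε) l *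
      sigmaPoch s η (α + (N + 3) * η) l) ham hh
    (mul_ne_zero (mul_ne_zero (mul_ne_zero (mul_ne_zero (mul_ne_zero hH (mul_ne_zero hb hB))
      (mul_ne_zero hc hC)) (mul_ne_zero hd hD)) hF) hR) hf0 hf1 hfl hr1 hr2 hrl key
  unfold sigmaWeight
  rw [eα, sigmaPoch_succ' s η β, sigmaPoch_succ' s η γ, sigmaPoch_succ' s η δ,
    sigmaPoch_succ s η (ε + η), sigmaPoch_succ' s η ε, sigmaPoch_succ' s η (-(N + 1) * η),
    sigmaPoch_succ s η (-N * η), sigmaPoch_succ s η η, sigmaPoch_succ' s η (α + η - β),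
    sigmaPoch_succ' s η (α + η - γ), sigmaPoch_succ' s η (α + η - δ),
    sigmaPoch_succ' s η (α + η - (ε + η)), sigmaPoch_succ' s η (α + η - ε),
    sigmaPoch_succ s η (α + η - -(N + 1) * η), sigmaPoch_succ' s η (α + η - -N * η),
    cong l (show α + η - β + η = α + 2 * η - β by ring),
    cong l (show α + η - γ + η = α + 2 * η - γ by ring),
    cong l (show α + η - δ + η = α + 2 * η - δ by ring),
    cong l (show α + η - ε + η = α + 2 * η - ε by ring),
    cong l (show α + η - (ε + η) + η = α + η - ε by ring),
    cong l (show -(N + 1) * η + η = -N * η by ring),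
    cong l (show α + η - -(N + 1) * η = α + (N + 2) * η by ring),
    cong l (show α + η - -N * η + η = α + (N + 2) * η by ring),
    cong l (show α + 2 * η + η - (β + η) = α + 2 * η - β by ring),
    cong l (show α + 2 * η + η - (γ + η) = α + 2 * η - γ by ring),
    cong l (show α + 2 * η + η - (δ + η) = α + 2 * η - δ by ring),
    cong l (show α + 2 * η + η - (ε + η) = α + 2 * η - ε by ring),
    cong l (show α + 2 * η + η - -N * η = α + (N + 3) * η by ring),
    show α + η - (ε + η) = α - ε by ring, show α + η - -N * η = α + (N + 1) * η by ring,
    show α + η - -(N + 1) * η + l * η = α + (N + 2) * η + l * η by ring, eF0, eR0,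
    show α + 2 * (l + 1 : ℕ) * η = α + 2 * η + 2 * l * η by push_cast; ring]
  -- The very-well-poised numerator is common to all three weights; beyond `main` it only remains to
  -- trade `1 / s α` for `1 / s (α + 2 * η)`.
  generalize s (α + 2 * η + 2 * l * η) = A at *
  rw [div_mul_cancel₀ _ hrl]
  refine Eq.trans (?_ : _ = A / s α * _) ((congrArg (A / s α * ·) main).trans ?_)
  · ring
  · have cancel : ∀ {x y : ℂ} (T : ℂ), x ≠ 0 → y ≠ 0 → A / x * (x * T) = A / y * (y * T) :=
      fun T hx hy => by field_simp
    refine Eq.trans (?_ : _ = A / s α * (s α * (-(s (ε + (N + 1) * η) * s (α - ε + (N + 1) * η) *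
          (s (α + η) * s β * s γ * s δ) /
          (s (α - ε) * s (α + η - ε) * s (α + (N + 1) * η) * s (α + (N + 2) * η) *
            (s (α + η - β) * s (α + η - γ) * s (α + η - δ)))) *
        (sigmaPoch s η (α + 2 * η) l * sigmaPoch s η (β + η) l * sigmaPoch s η (γ + η) l *
          sigmaPoch s η (δ + η) l * sigmaPoch s η (ε + η) l * sigmaPoch s η (-N * η) l /
          (sigmaPoch s η η l * sigmaPoch s η (α + 2 * η - β) l *
            sigmaPoch s η (α + 2 * η - γ) l * sigmaPoch s η (α + 2 * η - δ) l *
            sigmaPoch s η (α + 2 * η - ε) l * sigmaPoch s η (α + (N + 3) * η) l)))))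
      ((cancel _ h0 h2).trans ?_)
    · ring
    · ring

/-- The cancellation in the inductive step, with the addition formula isolated in `key`. -/
theorem frenkelTuraev_step_aux {K : Type*} [Field K]
    {L Q V m m' m1 m2 m3 b0 c0 d0 b1 c1 d1 l1 lm l' x0 x1 e1 w : K}
    (hm : m ≠ 0) (hm' : m' ≠ 0) (hb0 : b0 ≠ 0) (hc0 : c0 ≠ 0) (hd0 : d0 ≠ 0)
    (hb1 : b1 ≠ 0) (hc1 : c1 ≠ 0) (hd1 : d1 ≠ 0) (hl1 : l1 ≠ 0) (hlm : lm ≠ 0) (hl' : l' ≠ 0)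
    (hx0 : x0 ≠ 0) (hx1 : x1 ≠ 0) (hV : V ≠ 0)
    (key : m * m1 * m2 * m3 = b1 * c1 * d1 * l1 + e1 * w) :
    L * Q / V - e1 * -lm * (x0 * x1 * w) / (-l1 * -l' * m * m' * (b0 * c0 * d0)) *
        ((L * m * m' / (x0 * x1)) * Q /
          (V * (b1 / b0) * (c1 / c0) * (d1 / d0) * (lm / l'))) =
      L * m * (Q * m1 * m2 * m3) / (V * b1 * c1 * d1 * l1) := by
  have h1 : e1 * -lm * (x0 * x1 * w) / (-l1 * -l' * m * m' * (b0 * c0 * d0)) *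
        ((L * m * m' / (x0 * x1)) * Q /
          (V * (b1 / b0) * (c1 / c0) * (d1 / d0) * (lm / l'))) =
      -(e1 * w * L * Q / (V * l1 * b1 * c1 * d1)) := by
    field_simp
  have h2 : L * m * (Q * m1 * m2 * m3) / (V * b1 * c1 * d1 * l1) =
      L * Q * (m * m1 * m2 * m3) / (V * b1 * c1 * d1 * l1) := by ring
  rw [h1, h2, key]
  field_simp
  ring

/-- The Frenkel–Turaev summation for generic parameters. -/
theorem frenkelTuraev_generic {s : ℂ → ℂ} (hs : IsWeierstrassSigma s) {η : ℂ} (N : ℕ) :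
    ∀ {α β γ δ ε : ℂ}, (∀ k : ℤ, s (α + k * η) ≠ 0) → (∀ k : ℤ, s (α - β + k * η) ≠ 0) →
    (∀ k : ℤ, s (α - γ + k * η) ≠ 0) → (∀ k : ℤ, s (α - δ + k * η) ≠ 0) →
    (∀ k : ℤ, s (α - ε + k * η) ≠ 0) → sigmaPoch s η η N ≠ 0 →
    β + γ + δ + ε = (N + 1) * η + 2 * α →
    ∑ k ∈ Finset.range (N + 1), sigmaWeight s η α β γ δ ε (-N * η) k =
      sigmaPoch s η (α + η) N * (sigmaPoch s η (α + η - β - γ) N *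
        sigmaPoch s η (α + η - β - δ) N * sigmaPoch s η (α + η - γ - δ) N) /
      (sigmaPoch s η (α + η - β) N * sigmaPoch s η (α + η - γ) N *
        sigmaPoch s η (α + η - δ) N * sigmaPoch s η (α + η - β - γ - δ) N) := by
  induction N with
  | zero =>
    intro α β γ δ ε hα _ _ _ _ _ _
    have h0 : s α ≠ 0 := sigma_ne_zero_of_int hα 0 (by simp)
    simp [sigmaWeight_zero h0]
  | succ N ih =>
    intro α β γ δ ε' hα hβ hγ hδ hε' hη hbal
    -- With `ε' = ε + η`, both `(α, β, γ, δ, ε)` and `(α + 2η, β + η, γ + η, δ + η, ε + η)` are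
    -- balanced at level `N`, so the induction hypothesis applies to each.
    obtain ⟨ε, rfl⟩ : ∃ ε, ε' = ε + η := ⟨ε' - η, by ring⟩
    have shift : ∀ {u v : ℂ} (m : ℤ), (∀ k : ℤ, s (u + k * η) ≠ 0) → v = u + m * η →
        ∀ k : ℤ, s (v + k * η) ≠ 0 := fun m h hv k =>
      sigma_ne_zero_of_int h (m + k) (by rw [hv]; push_cast; ring)
    have hε := shift (v := α - ε) 1 hε' (by push_cast; ring)
    push_cast at hbal
    have hbal' : β + γ + δ + ε = (N + 1) * η + 2 * α := by linear_combination hbal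
    have hη' : sigmaPoch s η η N ≠ 0 := sigmaPoch_ne_zero_of_le hη (Nat.le_succ N)
    have h0 : s α ≠ 0 := sigma_ne_zero_of_int hα 0 (by simp)
    have ih1 := ih hα hβ hγ hδ hε hη' hbal'
    have ih2 := ih (α := α + 2 * η) (β := β + η) (γ := γ + η) (δ := δ + η) (ε := ε + η)
      (shift 2 hα (by push_cast; ring)) (shift 1 hβ (by push_cast; ring))
      (shift 1 hγ (by push_cast; ring)) (shift 1 hδ (by push_cast; ring))
      (shift 1 hε (by push_cast; ring)) hη' (by linear_combination hbal')
    -- The factor `s 0` ends the level-`N` series, so it may be compared termwise with the longer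
    -- level-`N + 1` series.
    have last : sigmaWeight s η α β γ δ ε (-N * η) (N + 1) = 0 := by
      have h00 : s 0 = 0 := by
        have := hs.odd 0
        rw [neg_zero] at this
        linear_combination this / 2
      rw [sigmaWeight, sigmaPoch_succ s η (-N * η), show -N * η + N * η = 0 by ring, h00]
      simp
    have step : ∑ k ∈ Finset.range (N + 2),
          sigmaWeight s η α β γ δ (ε + η) (-(N + 1) * η) k =
        ∑ k ∈ Finset.range (N + 1), sigmaWeight s η α β γ δ ε (-N * η) k +
        ∑ l ∈ Finset.range (N + 1), (sigmaWeight s η α β γ δ (ε + η) (-(N + 1) * η) (l + 1) -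
          sigmaWeight s η α β γ δ ε (-N * η) (l + 1)) := by
      rw [← add_zero (∑ k ∈ Finset.range (N + 1), sigmaWeight s η α β γ δ ε (-N * η) k), ← last,
        ← Finset.sum_range_succ, Finset.sum_sub_distrib, Finset.sum_range_succ',
        Finset.sum_range_succ' _ (N + 1), sigmaWeight_zero h0, sigmaWeight_zero h0]
      ring
    -- By the balancing condition these arguments are negatives of `α - ε` shifted by multiples of
    -- `η`.
    have hΛ : ∀ k : ℤ, s (α + η - β - γ - δ + k * η) ≠ 0 := fun k => by
      have := hε (-(k - N))
      rw [show α - ε + ((-(k - N) : ℤ) : ℂ) * η = -(α + η - β - γ - δ + k * η) by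
        push_cast; linear_combination -hbal', hs.odd] at this
      exact neg_ne_zero.1 this
    have eL : sigmaPoch s η (α + 2 * η + η) N = sigmaPoch s η (α + η) N * s (α + (N + 1) * η) *
        s (α + (N + 2) * η) / (s (α + η) * s (α + 2 * η)) := by
      have h1 : s (α + η) ≠ 0 := sigma_ne_zero_of_int hα 1 (by simp)
      have h2 : s (α + 2 * η) ≠ 0 := sigma_ne_zero_of_int hα 2 (by simp)
      have e := sigmaPoch_succ' s η (α + η) (N + 1)
      rw [sigmaPoch_succ, sigmaPoch_succ, sigmaPoch_succ', show α + η + η = α + 2 * η by ring,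
        show α + η + N * η = α + (N + 1) * η by ring,
        show α + η + (N + 1 : ℕ) * η = α + (N + 2) * η by push_cast; ring] at e
      rw [e]
      field_simp
    have eB : ∀ u : ℂ, s (α + η - u) ≠ 0 → sigmaPoch s η (α + 2 * η + η - (u + η)) N =
        sigmaPoch s η (α + η - u) N * (s (α + η - u + N * η) / s (α + η - u)) := fun u hu => by
      rw [mul_div_assoc', ← sigmaPoch_succ, sigmaPoch_succ', mul_div_cancel_left₀ _ hu]
      congr 1
      ring
    have el : sigmaPoch s η (α + 2 * η + η - (β + η) - (γ + η) - (δ + η)) N =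
        sigmaPoch s η (α + η - β - γ - δ) N * (s (α - β - γ - δ) /
          s (α - β - γ - δ + N * η)) := by
      have hne : s (α - β - γ - δ + N * η) ≠ 0 :=
        sigma_ne_zero_of_int hΛ (N - 1) (by push_cast; ring)
      rw [mul_div_assoc', eq_div_iff hne, show α + 2 * η + η - (β + η) - (γ + η) - (δ + η) =
        α - β - γ - δ by ring, ← sigmaPoch_succ, sigmaPoch_succ', mul_comm]
      congr 2
      ring
    have hb0 : s (α + η - β) ≠ 0 := sigma_ne_zero_of_int hβ 1 (by push_cast; ring)
    have hc0 : s (α + η - γ) ≠ 0 := sigma_ne_zero_of_int hγ 1 (by push_cast; ring)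
    have hd0 : s (α + η - δ) ≠ 0 := sigma_ne_zero_of_int hδ 1 (by push_cast; ring)
    have nz : ∀ {u v : ℂ} (m : ℤ), (∀ k : ℤ, s (u + k * η) ≠ 0) → v = u + m * η →
        sigmaPoch s η v N ≠ 0 := fun m h hv => sigmaPoch_ne_zero_of_int h m hv N
    have key : s (α + (N + 1) * η) * s (α + η - β - γ + N * η) * s (α + η - β - δ + N * η) *
        s (α + η - γ - δ + N * η) = s (α + η - β + N * η) * s (α + η - γ + N * η) *
        s (α + η - δ + N * η) * s (α + η - β - γ - δ + N * η) +
        s (ε + (N + 1) * η) * (s β * s γ * s δ) := by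
      have add := hs.add (α + (N + 1) * η - (β + γ) / 2) ((β + γ) / 2)
        (α + (N + 1) * η - δ - (β + γ) / 2) ((γ - β) / 2)
      rw [show ε + (N + 1) * η = α + (N + 1) * η - (β + γ) / 2 +
        (α + (N + 1) * η - δ - (β + γ) / 2) by linear_combination hbal']
      ring_nf at add ⊢
      linear_combination add
    have main := frenkelTuraev_step_aux (L := sigmaPoch s η (α + η) N)
      (Q := sigmaPoch s η (α + η - β - γ) N * sigmaPoch s η (α + η - β - δ) N *
        sigmaPoch s η (α + η - γ - δ) N)
      (V := sigmaPoch s η (α + η - β) N * sigmaPoch s η (α + η - γ) N *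
        sigmaPoch s η (α + η - δ) N * sigmaPoch s η (α + η - β - γ - δ) N)
      (m := s (α + (N + 1) * η)) (m' := s (α + (N + 2) * η))
      (b0 := s (α + η - β)) (c0 := s (α + η - γ)) (d0 := s (α + η - δ))
      (l1 := s (α + η - β - γ - δ + N * η)) (lm := s (α - β - γ - δ))
      (l' := s (α - β - γ - δ + N * η)) (x0 := s (α + η)) (x1 := s (α + 2 * η))
      (sigma_ne_zero_of_int hα (N + 1) (by push_cast; ring))
      (sigma_ne_zero_of_int hα (N + 2) (by push_cast; ring)) hb0 hc0 hd0
      (sigma_ne_zero_of_int hβ (N + 1) (by push_cast; ring))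
      (sigma_ne_zero_of_int hγ (N + 1) (by push_cast; ring))
      (sigma_ne_zero_of_int hδ (N + 1) (by push_cast; ring))
      (sigma_ne_zero_of_int hΛ N (by push_cast; ring))
      (sigma_ne_zero_of_int hΛ (-1) (by push_cast; ring))
      (sigma_ne_zero_of_int hΛ (N - 1) (by push_cast; ring))
      (sigma_ne_zero_of_int hα 1 (by push_cast; ring))
      (sigma_ne_zero_of_int hα 2 (by push_cast; ring))
      (mul_ne_zero (mul_ne_zero (mul_ne_zero (nz 1 hβ (by push_cast; ring))
        (nz 1 hγ (by push_cast; ring))) (nz 1 hδ (by push_cast; ring)))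
        (nz 0 hΛ (by push_cast; ring))) key
    have contig : ∀ l ∈ Finset.range (N + 1), _ := fun l hl =>
      sigmaWeight_contiguous hs N l hα hβ hγ hδ hε
        (sigmaPoch_ne_zero_of_le hη (by have := Finset.mem_range.1 hl; omega))
    push_cast
    rw [step, Finset.sum_congr rfl contig, ← Finset.mul_sum, ih1, ih2, eL, eB β hb0, eB γ hc0,
      eB δ hd0, el, show α + 2 * η + η - (β + η) - (γ + η) = α + η - β - γ by ring,
      show α + 2 * η + η - (β + η) - (δ + η) = α + η - β - δ by ring,
      show α + 2 * η + η - (γ + η) - (δ + η) = α + η - γ - δ by ring,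
      show α - ε = -(α + η - β - γ - δ + N * η) by linear_combination -hbal', hs.odd,
      show α + η - ε = -(α - β - γ - δ + N * η) by linear_combination -hbal', hs.odd,
      show -(α + η - β - γ - δ + N * η) + (N + 1) * η = -(α - β - γ - δ) by ring, hs.odd,
      neg_mul, ← sub_eq_add_neg]
    simp only [sigmaPoch_succ]
    rw [show α + η + N * η = α + (N + 1) * η by ring]
    refine Eq.trans ?_ (main.trans ?_)
    · ring
    · ring

/-! ### Bracket determinants and the Cauchy–Binet identity. -/

/-- The coefficients are chosen before `f` and `g`, so one coefficient matrix serves every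
evaluation point. Vanishing beyond the degree is what the induction needs. -/
theorem exists_coeff_prod_linear {K ι : Type*} [Field K] (S : Finset ι) (a b : ι → K) :
    ∃ c : ℕ → K, (∀ i, S.card < i → c i = 0) ∧ ∀ f g : K, ∏ m ∈ S, (a m * f + b m * g) =
      ∑ i ∈ Finset.range (S.card + 1), c i * (f ^ i * g ^ (S.card - i)) := by
  classical
  induction S using Finset.induction_on with
  | empty => exact ⟨fun i => if i = 0 then 1 else 0, fun i hi => by
      simp at hi; simp [hi.ne'], fun f g => by simp⟩
  | insert m S hm ih =>
    obtain ⟨c, hc0, hc⟩ := ih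
    refine ⟨fun i => b m * c i + (if i = 0 then 0 else a m * c (i - 1)), fun i hi => ?_,
      fun f g => ?_⟩
    · rw [Finset.card_insert_of_notMem hm] at hi
      simp [hc0 i (by omega), hc0 (i - 1) (by omega)]
    · rw [Finset.prod_insert hm, hc, Finset.card_insert_of_notMem hm]
      simp only [add_mul, Finset.sum_add_distrib]
      rw [Finset.sum_range_succ (fun i => b m * c i * _), hc0 (S.card + 1) (by omega),
        Finset.sum_range_succ' (fun i => (if i = 0 then 0 else _) * _)]
      simp only [Nat.succ_ne_zero, if_false, if_true, Nat.add_sub_cancel, Finset.mul_sum]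
      rw [add_comm]
      have h1 : ∀ i ∈ Finset.range (S.card + 1), b m * g * (c i * (f ^ i * g ^ (S.card - i))) =
          b m * c i * (f ^ i * g ^ (S.card + 1 - i)) := fun i hi => by
        rw [show S.card + 1 - i = S.card - i + 1 by have := Finset.mem_range.1 hi; omega]
        ring
      have h2 : ∀ i ∈ Finset.range (S.card + 1), a m * f * (c i * (f ^ i * g ^ (S.card - i))) =
          a m * c i * (f ^ (i + 1) * g ^ (S.card + 1 - (i + 1))) := fun i hi => by
        rw [Nat.add_sub_add_right]
        ring
      rw [Finset.sum_congr rfl h1, Finset.sum_congr rfl h2]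
      simp

/-- Determinant of products of brackets; the bracket is the area form in homogeneous coordinates. -/
theorem det_prod_bracket {n : ℕ} {br : ℂ → ℂ → ℂ} {f g : ℂ → ℂ}
    (hbr : ∀ x y, br x y = f x * g y - f y * g x) (β γ : ℕ → ℂ) (v : Fin n → ℂ)
    (hβ : ∀ i j : ℕ, i < j → j < n → br (β i) (β j) ≠ 0) :
    (Matrix.of fun i j : Fin n => (∏ m ∈ Finset.range j, br (β m) (v i)) *
        ∏ m ∈ Finset.range (n - 1 - j), br (γ m) (v i)).det =
      (∏ i : Fin n, ∏ m ∈ Finset.range (n - 1 - i), br (γ m) (β i)) *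
        ∏ i : Fin n, ∏ j ∈ Finset.Ioi i, br (v i) (v j) := by
  -- Each column is a binary form of degree `n - 1` evaluated at the rows, hence a projective
  -- Vandermonde matrix times a matrix `C` that does not depend on `v`. It suffices to find `C.det`
  -- from the single choice `v i = β i`.
  obtain ⟨C, hC⟩ : ∃ C : Matrix (Fin n) (Fin n) ℂ, ∀ v : Fin n → ℂ,
      (Matrix.of fun i j : Fin n => (∏ m ∈ Finset.range j, br (β m) (v i)) *
        ∏ m ∈ Finset.range (n - 1 - j), br (γ m) (v i)) =
      Matrix.projVandermonde (f ∘ v) (g ∘ v) * C := by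
    choose c _ hc using fun j : Fin n => exists_coeff_prod_linear
      ((Finset.range j).disjSum (Finset.range (n - 1 - j)))
      (Sum.elim (fun m => -g (β m)) (fun m => -g (γ m)))
      (Sum.elim (fun m => f (β m)) (fun m => f (γ m)))
    refine ⟨Matrix.of fun i j => c j i, fun v => ?_⟩
    ext i j
    have h := hc j (f (v i)) (g (v i))
    have hj := j.2
    rw [Finset.prod_disjSum, Finset.card_disjSum, Finset.card_range, Finset.card_range,
      show (j : ℕ) + (n - 1 - j) = n - 1 by omega, show n - 1 + 1 = n by omega,
      ← Fin.sum_univ_eq_sum_range (fun k => c j k * (f (v i) ^ k * g (v i) ^ (n - 1 - k)))] at h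
    rw [Matrix.mul_apply]
    simp only [Matrix.projVandermonde_apply, Matrix.of_apply, Function.comp, hbr]
    refine Eq.trans (Eq.trans ?_ h) ?_
    · congr 1 <;> refine Finset.prod_congr rfl fun m _ => ?_ <;> simp <;> ring
    · refine Finset.sum_congr rfl fun k _ => ?_
      rw [Fin.val_rev, show n - (k + 1 : ℕ) = n - 1 - k by omega]
      ring
  have area : ∀ v : Fin n → ℂ, (Matrix.projVandermonde (f ∘ v) (g ∘ v)).det =
      (∏ i : Fin n, ∏ j ∈ Finset.Ioi i, (-1 : ℂ)) *
        ∏ i : Fin n, ∏ j ∈ Finset.Ioi i, br (v i) (v j) := fun v => by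
    rw [Matrix.det_projVandermonde, ← Finset.prod_mul_distrib]
    refine Finset.prod_congr rfl fun i _ => ?_
    rw [← Finset.prod_mul_distrib]
    refine Finset.prod_congr rfl fun j _ => ?_
    simp only [hbr, Function.comp]
    ring
  -- Above the diagonal, `i < j`, the first product contains `br (β i) (β i) = 0`.
  have diag : (Matrix.of fun i j : Fin n => (∏ m ∈ Finset.range j, br (β m) (β i)) *
        ∏ m ∈ Finset.range (n - 1 - j), br (γ m) (β i)).det =
      (∏ i : Fin n, ∏ m ∈ Finset.range (n - 1 - i), br (γ m) (β i)) *
        ∏ i : Fin n, ∏ j ∈ Finset.Ioi i, br (β i) (β j) := by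
    rw [Matrix.det_of_isLowerTriangular]
    · simp only [Matrix.of_apply, Finset.prod_mul_distrib]
      rw [mul_comm]
      congr 1
      rw [Finset.prod_comm' (t' := Finset.univ) (s' := fun j : Fin n => Finset.Iio j)
        (fun x y => by simp)]
      refine Finset.prod_congr rfl fun j _ => ?_
      refine (Finset.prod_bij (fun (i : Fin n) _ => (i : ℕ)) ?_ ?_ ?_ ?_).symm
      · intro i hi; simpa using hi
      · intro i _ i' _ h; exact Fin.ext h
      · intro m hm
        have := Finset.mem_range.1 hm
        exact ⟨⟨m, by omega⟩, by simpa [Fin.lt_def] using this, rfl⟩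
      · intro i _; rfl
    · intro i j hij
      have hij : i < j := by simpa using hij
      simp only [Matrix.of_apply]
      rw [Finset.prod_eq_zero (i := (i : ℕ)) (Finset.mem_range.2 hij) (by rw [hbr]; ring), zero_mul]
  have hv := congrArg Matrix.det (hC v)
  have hb := congrArg Matrix.det (hC fun i => β i)
  rw [Matrix.det_mul, area] at hv hb
  rw [diag] at hb
  have hne : ∏ i : Fin n, ∏ j ∈ Finset.Ioi i, br (β i) (β j) ≠ 0 :=
    Finset.prod_ne_zero_iff.2 fun i _ => Finset.prod_ne_zero_iff.2 fun j hj =>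
      hβ i j (Fin.lt_def.1 (Finset.mem_Ioi.1 hj)) j.2
  have hsign : (∏ i : Fin n, ∏ j ∈ Finset.Ioi i, (-1 : ℂ)) * C.det =
      ∏ i : Fin n, ∏ m ∈ Finset.range (n - 1 - i), br (γ m) (β i) :=
    mul_right_cancel₀ hne (by rw [hb]; ring)
  rw [hv, ← hsign]
  ring

/-- If `s c ≠ 0`, the addition formula with `u = c`, `v = 0` expresses every bracket through `s x ^
2` and `s (c + x) * s (c - x)`, which serve as homogeneous coordinates. -/
theorem IsWeierstrassSigma.exists_area {s : ℂ → ℂ} (hs : IsWeierstrassSigma s) :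
    ∃ f g : ℂ → ℂ, ∀ x y, s (x + y) * s (x - y) = f x * g y - f y * g x := by
  by_cases h : ∀ c, s c = 0
  · exact ⟨0, 0, fun x y => by simp [h]⟩
  · push Not at h
    obtain ⟨c, hc⟩ := h
    refine ⟨fun x => s x * s x / (s c * s c), fun y => s (c + y) * s (c - y), fun x y => ?_⟩
    have h := hs.add x y c 0
    simp only [add_zero, sub_zero] at h
    have ho : s (x - c) = -s (c - x) := by rw [← hs.odd]; congr 1; ring
    rw [ho, add_comm x c] at h
    field_simp
    linear_combination h

/-- The Cauchy–Binet (Andréief) identity over increasing tuples. -/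
theorem sum_increasingTuples_det_mul_det {n N : ℕ} (f g : Fin n → Fin (N + 1) → ℂ) :
    ∑ x ∈ increasingTuples n N, (Matrix.of fun i j => f j (x i)).det *
        (Matrix.of fun i j => g j (x i)).det =
      (Matrix.of fun j k => ∑ y, f j y * g k y).det := by
  -- Multilinearity in the rows expands the determinant over all tuples; repeated entries then
  -- contribute zero.
  have h1 : (Matrix.of fun j k => ∑ y, f j y * g k y).det =
      ∑ x : Fin n → Fin (N + 1), (∏ j, f j (x j)) * (Matrix.of fun j k => g k (x j)).det := by
    have : (Matrix.of fun j k => ∑ y, f j y * g k y) =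
        fun j => ∑ y, f j y • fun k => g k y := by
      ext j k
      simp [Finset.sum_apply]
    rw [this]
    refine ((Matrix.detRowAlternating (n := Fin n) (R := ℂ)).toMultilinearMap.map_sum
      (fun j y => f j y • fun k => g k y)).trans ?_
    refine Finset.sum_congr rfl fun x _ => ?_
    exact (Matrix.detRowAlternating (n := Fin n) (R := ℂ)).toMultilinearMap.map_smul_univ
      (fun j => f j (x j)) (fun j k => g k (x j))
  have h2 : ∑ x : Fin n → Fin (N + 1), (∏ j, f j (x j)) * (Matrix.of fun j k => g k (x j)).det =
      ∑ x : Fin n → Fin (N + 1) with Function.Injective x,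
        (∏ j, f j (x j)) * (Matrix.of fun j k => g k (x j)).det := by
    refine (Finset.sum_subset (Finset.filter_subset _ _) fun x _ hx => ?_).symm
    obtain ⟨i, j, hij, hne⟩ := Function.not_injective_iff.1 (by simpa using hx)
    rw [Matrix.det_zero_of_row_eq hne (by ext k; simp [hij]), mul_zero]
  -- An injective tuple is uniquely an increasing one composed with a permutation, found by sorting.
  -- Summing over that permutation rebuilds the determinant of `f`.
  have h3 : ∑ p ∈ increasingTuples n N ×ˢ (Finset.univ : Finset (Equiv.Perm (Fin n))),
        (∏ j, f j (p.1 (p.2 j))) * (Matrix.of fun j k => g k (p.1 (p.2 j))).det =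
      ∑ x : Fin n → Fin (N + 1) with Function.Injective x,
        (∏ j, f j (x j)) * (Matrix.of fun j k => g k (x j)).det := by
    have mono : ∀ x, x ∈ increasingTuples n N ↔ StrictMono x := fun x => by
      simp [increasingTuples, StrictMono]
    refine Finset.sum_bij (fun p _ => p.1 ∘ p.2) ?_ ?_ ?_ ?_
    · rintro ⟨x, π⟩ hp
      have hx := (mono x).1 (Finset.mem_product.1 hp).1
      simpa using hx.injective
    · rintro ⟨x, π⟩ hp ⟨y, ρ⟩ hq h
      have hx := (mono x).1 (Finset.mem_product.1 hp).1
      have hy := (mono y).1 (Finset.mem_product.1 hq).1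
      have hxy : x = y := (hx.range_inj hy).1 (by
        rw [← π.surjective.range_comp x, ← ρ.surjective.range_comp y]
        exact congrArg Set.range h)
      subst hxy
      refine Prod.ext rfl (Equiv.ext fun i => hx.injective (congrFun h i))
    · intro x hx
      have hx : Function.Injective x := by simpa using hx
      refine ⟨(x ∘ Tuple.sort x, (Tuple.sort x)⁻¹), ?_, ?_⟩
      · refine Finset.mem_product.2 ⟨(mono _).2 ?_, Finset.mem_univ _⟩
        exact (Tuple.monotone_sort x).strictMono_of_injective
          (hx.comp (Tuple.sort x).injective)
      · ext i
        simp
    · rintro ⟨x, π⟩ _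
      rfl
  rw [h1, h2, ← h3, Finset.sum_product]
  refine Finset.sum_congr rfl fun x _ => ?_
  have h4 : ∀ π : Equiv.Perm (Fin n), (Matrix.of fun j k => g k (x (π j))).det =
      Equiv.Perm.sign π * (Matrix.of fun i j => g j (x i)).det := fun π =>
    Matrix.det_permute π (Matrix.of fun i j => g j (x i))
  rw [Matrix.det_apply', Finset.sum_mul]
  refine Finset.sum_congr rfl fun π _ => ?_
  rw [h4]
  simp only [Matrix.of_apply]
  ring

/-! ### Evaluation of the matrix entries. -/

/-- The bracket `⟨x, y⟩ = s (x + y) s (x - y)`. -/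
def sigmaBracket (s : ℂ → ℂ) (x y : ℂ) : ℂ :=
  s (x + y) * s (x - y)

theorem prod_sigmaBracket (s : ℂ → ℂ) (η u v : ℂ) (k : ℕ) :
    ∏ m ∈ Finset.range k, sigmaBracket s (u + m * η) v =
      sigmaPoch s η (u + v) k * sigmaPoch s η (u - v) k := by
  simp only [sigmaBracket, sigmaPoch, ← Finset.prod_mul_distrib]
  refine Finset.prod_congr rfl fun m _ => ?_
  congr 2 <;> ring

theorem sigmaPoch_congr {s : ℂ → ℂ} {η u v : ℂ} (h : u = v) (k : ℕ) :
    sigmaPoch s η u k = sigmaPoch s η v k := by rw [h]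

theorem neg_one_pow_mul_self (k : ℕ) : (-1 : ℂ) ^ k * (-1) ^ k = 1 := by
  rw [← mul_pow]; simp

section

variable {s : ℂ → ℂ} (hs : IsWeierstrassSigma s)
include hs

/-- Brackets based at `β` are absorbed into the weight by moving `β` to `β + j * η`. One factor of
each bracket extends `(β)_y` to `(β)_(y+j)`; the other, after reflection, does the same for the
denominator. -/
theorem sigmaPoch_shift_ratio {η α β : ℂ} (j y : ℕ)
    (h1 : sigmaPoch s η (α + η - β) y ≠ 0) (h2 : sigmaPoch s η (α + η - (β + j * η)) y ≠ 0) :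
    (∏ m ∈ Finset.range j, sigmaBracket s (β - α / 2 + m * η) (α / 2 + y * η)) *
        (sigmaPoch s η β y / sigmaPoch s η (α + η - β) y) =
      sigmaPoch s η β j * sigmaPoch s η (β - α) j *
        (sigmaPoch s η (β + j * η) y / sigmaPoch s η (α + η - (β + j * η)) y) := by
  have e1 : sigmaPoch s η β y * sigmaPoch s η (β + y * η) j =
      sigmaPoch s η β j * sigmaPoch s η (β + j * η) y := by
    rw [← sigmaPoch_add, add_comm, sigmaPoch_add]
  have e2 : sigmaPoch s η (β - α - y * η) j * sigmaPoch s η (α + η - (β + j * η)) y =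
      sigmaPoch s η (β - α) j * sigmaPoch s η (α + η - β) y := by
    have h := sigmaPoch_add s η (α + η - (β + j * η)) y j
    rw [add_comm y j, sigmaPoch_add, sigmaPoch_congr
      (show α + η - (β + j * η) + j * η = α + η - β by ring)] at h
    rw [sigmaPoch_reflect hs.odd η (β - α - y * η), sigmaPoch_reflect hs.odd η (β - α),
      sigmaPoch_congr (show -(β - α - y * η) - j * η + η = α + η - (β + j * η) + y * η by ring),
      sigmaPoch_congr (show -(β - α) - j * η + η = α + η - (β + j * η) by ring)]
    linear_combination -(-1) ^ j * h
  rw [prod_sigmaBracket, show β - α / 2 + (α / 2 + y * η) = β + y * η by ring,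
    show β - α / 2 - (α / 2 + y * η) = β - α - y * η by ring, mul_div_assoc', mul_div_assoc',
    div_eq_div_iff h1 h2]
  linear_combination sigmaPoch s η (β - α - y * η) j * sigmaPoch s η (α + η - (β + j * η)) y * e1 +
    sigmaPoch s η β j * sigmaPoch s η (β + j * η) y * e2

/-- Up to sign, `sigmaPoch s η (β - α) j` is the reflected initial block of the denominator, which
cancels and leaves the remaining `N - j` factors. -/
theorem sigmaPoch_reflect_div {η α β : ℂ} {j N : ℕ} (hj : j ≤ N)
    (h : sigmaPoch s η (α + η - (β + j * η)) N ≠ 0) :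
    sigmaPoch s η (β - α) j / sigmaPoch s η (α + η - (β + j * η)) N =
      (-1) ^ j / sigmaPoch s η (α + η - β) (N - j) := by
  obtain ⟨m, rfl⟩ := Nat.exists_eq_add_of_le hj
  have e := sigmaPoch_add s η (α + η - (β + j * η)) j m
  rw [sigmaPoch_congr (show α + η - (β + j * η) + j * η = α + η - β by ring)] at e
  rw [e] at h ⊢
  have ha := left_ne_zero_of_mul h
  rw [sigmaPoch_reflect hs.odd η (β - α),
    sigmaPoch_congr (show -(β - α) - j * η + η = α + η - (β + j * η) by ring),
    Nat.add_sub_cancel_left, mul_comm ((-1) ^ j), mul_div_mul_left _ _ ha]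

/-- Splitting off the factors common to a column of the matrix of summed entries. -/
theorem sigmaPoch_split {η A B : ℂ} {n N k : ℕ} (hk : k < n) (hn : n ≤ N + 1) :
    sigmaPoch s η (A - k * η) N * sigmaPoch s η (B - (n - 1 - k : ℕ) * η) N =
      (-1) ^ (n - 1) * (sigmaPoch s η A (N + 1 - n) * sigmaPoch s η B (N + 1 - n)) *
        ((∏ m ∈ Finset.range k, sigmaBracket s ((B - A + (N - n + 2) * η) / 2 + m * η)
            ((A + B + (N - n) * η) / 2)) *
          ∏ m ∈ Finset.range (n - 1 - k), sigmaBracket s ((A - B + (N - n + 2) * η) / 2 + m * η)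
            ((A + B + (N - n) * η) / 2)) := by
  obtain ⟨l, rfl⟩ : ∃ l, n = k + 1 + l := Nat.exists_eq_add_of_le hk
  obtain ⟨M, rfl⟩ : ∃ M, N = k + l + M := Nat.exists_eq_add_of_le (by omega)
  rw [show k + 1 + l - 1 - k = l by omega, show k + l + M + 1 - (k + 1 + l) = M by omega,
    show k + 1 + l - 1 = k + l by omega, prod_sigmaBracket, prod_sigmaBracket]
  -- The `N` factors form blocks of lengths `k`, `N + 1 - n` and `n - 1 - k`. The middle block is
  -- independent of `k`; the reflected left block for `A` pairs with the right block for `B` into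
  -- brackets, and conversely.
  have eA : sigmaPoch s η (A - k * η) (k + l + M) = sigmaPoch s η (A - k * η) k *
      sigmaPoch s η A M * sigmaPoch s η (A + M * η) l := by
    rw [show k + l + M = k + M + l by ring, sigmaPoch_add, sigmaPoch_add,
      sigmaPoch_congr (show A - k * η + k * η = A by ring)]
    congr 2
    push_cast
    ring
  have eB : sigmaPoch s η (B - l * η) (k + l + M) = sigmaPoch s η (B - l * η) l *
      sigmaPoch s η B M * sigmaPoch s η (B + M * η) k := by
    rw [show k + l + M = l + M + k by ring, sigmaPoch_add, sigmaPoch_add,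
      sigmaPoch_congr (show B - l * η + l * η = B by ring)]
    congr 2
    push_cast
    ring
  push_cast
  rw [eA, eB, sigmaPoch_reflect hs.odd η (A - k * η), sigmaPoch_reflect hs.odd η (B - l * η)]
  rw [sigmaPoch_congr (show (B - A + (k + l + M - (k + 1 + l) + 2) * η) / 2 +
      (A + B + (k + l + M - (k + 1 + l)) * η) / 2 = B + M * η by ring),
    sigmaPoch_congr (show (A - B + (k + l + M - (k + 1 + l) + 2) * η) / 2 +
      (A + B + (k + l + M - (k + 1 + l)) * η) / 2 = A + M * η by ring),
    sigmaPoch_congr (show (B - A + (k + l + M - (k + 1 + l) + 2) * η) / 2 -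
      (A + B + (k + l + M - (k + 1 + l)) * η) / 2 = -(A - k * η) - k * η + η by ring),
    sigmaPoch_congr (show (A - B + (k + l + M - (k + 1 + l) + 2) * η) / 2 -
      (A + B + (k + l + M - (k + 1 + l)) * η) / 2 = -(B - l * η) - l * η + η by ring)]
  ring

/-- The Frenkel–Turaev summation in a form distinguishing only one parameter. -/
theorem frenkelTuraev_generic' {η α β γ δ ε : ℂ} {N : ℕ}
    (hα : ∀ k : ℤ, s (α + k * η) ≠ 0) (hβ : ∀ k : ℤ, s (α - β + k * η) ≠ 0)
    (hγ : ∀ k : ℤ, s (α - γ + k * η) ≠ 0) (hδ : ∀ k : ℤ, s (α - δ + k * η) ≠ 0)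
    (hε : ∀ k : ℤ, s (α - ε + k * η) ≠ 0) (hη : sigmaPoch s η η N ≠ 0)
    (hbal : β + γ + δ + ε = (N + 1) * η + 2 * α) :
    ∑ k ∈ Finset.range (N + 1), sigmaWeight s η α β γ δ ε (-N * η) k =
      sigmaPoch s η (α + η) N * sigmaPoch s η (α + η - β - γ) N *
        (sigmaPoch s η (α + η - β - δ) N * sigmaPoch s η (α + η - β - ε) N) /
      (sigmaPoch s η (α + η - β) N * sigmaPoch s η (α + η - γ) N *
        (sigmaPoch s η (α + η - δ) N * sigmaPoch s η (α + η - ε) N)) := by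
  -- Balancing and reflection exchange the two factors not symmetric in `γ, δ, ε` for factors in
  -- `ε`; each reflection contributes `(-1) ^ N`, and these cancel in the quotient.
  rw [frenkelTuraev_generic hs N hα hβ hγ hδ hε hη hbal,
    sigmaPoch_reflect hs.odd η (α + η - γ - δ), sigmaPoch_reflect hs.odd η (α + η - β - γ - δ),
    sigmaPoch_congr (show -(α + η - γ - δ) - N * η + η = α + η - β - ε by
      linear_combination hbal),
    sigmaPoch_congr (show -(α + η - β - γ - δ) - N * η + η = α + η - ε by
      linear_combination hbal)]
  have h : (-1 : ℂ) ^ N ≠ 0 := by simp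
  rw [← mul_div_mul_left _ (sigmaPoch s η (α + η - β) N * sigmaPoch s η (α + η - γ) N *
        (sigmaPoch s η (α + η - δ) N * sigmaPoch s η (α + η - ε) N)) h]
  congr 1 <;> ring

end

section

variable {s : ℂ → ℂ} (hs : IsWeierstrassSigma s)
include hs

theorem sigmaWeight_mul_brackets {η α β γ δ ε : ℂ} (ν : ℂ) (j j' k k' y : ℕ)
    (hβ : ∀ k : ℤ, s (α - β + k * η) ≠ 0) (hγ : ∀ k : ℤ, s (α - γ + k * η) ≠ 0)
    (hδ : ∀ k : ℤ, s (α - δ + k * η) ≠ 0) (hε : ∀ k : ℤ, s (α - ε + k * η) ≠ 0) :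
    ((∏ m ∈ Finset.range j, sigmaBracket s (β - α / 2 + m * η) (α / 2 + y * η)) *
        ∏ m ∈ Finset.range j', sigmaBracket s (γ - α / 2 + m * η) (α / 2 + y * η)) *
      (((∏ m ∈ Finset.range k, sigmaBracket s (δ - α / 2 + m * η) (α / 2 + y * η)) *
        ∏ m ∈ Finset.range k', sigmaBracket s (ε - α / 2 + m * η) (α / 2 + y * η)) *
        sigmaWeight s η α β γ δ ε ν y) =
      (sigmaPoch s η β j * sigmaPoch s η (β - α) j *
          (sigmaPoch s η γ j' * sigmaPoch s η (γ - α) j') *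
        (sigmaPoch s η δ k * sigmaPoch s η (δ - α) k *
          (sigmaPoch s η ε k' * sigmaPoch s η (ε - α) k'))) *
        sigmaWeight s η α (β + j * η) (γ + j' * η) (δ + k * η) (ε + k' * η) ν y := by
  have nz : ∀ {u : ℂ} (i : ℕ), (∀ k : ℤ, s (α - u + k * η) ≠ 0) →
      sigmaPoch s η (α + η - (u + i * η)) y ≠ 0 := fun i h =>
    sigmaPoch_ne_zero_of_int h (1 - i) (by push_cast; ring) y
  have nz0 : ∀ {u : ℂ}, (∀ k : ℤ, s (α - u + k * η) ≠ 0) → sigmaPoch s η (α + η - u) y ≠ 0 :=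
    fun h => sigmaPoch_ne_zero_of_int h 1 (by push_cast; ring) y
  have eβ := sigmaPoch_shift_ratio hs j y (nz0 hβ) (nz j hβ)
  have eγ := sigmaPoch_shift_ratio hs j' y (nz0 hγ) (nz j' hγ)
  have eδ := sigmaPoch_shift_ratio hs k y (nz0 hδ) (nz k hδ)
  have eε := sigmaPoch_shift_ratio hs k' y (nz0 hε) (nz k' hε)
  have split : ∀ β γ δ ε : ℂ, sigmaWeight s η α β γ δ ε ν y =
      s (α + 2 * y * η) / s α * ((sigmaPoch s η α y * sigmaPoch s η ν y) /
        (sigmaPoch s η η y * sigmaPoch s η (α + η - ν) y)) *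
      ((sigmaPoch s η β y / sigmaPoch s η (α + η - β) y) *
        (sigmaPoch s η γ y / sigmaPoch s η (α + η - γ) y) *
        ((sigmaPoch s η δ y / sigmaPoch s η (α + η - δ) y) *
        (sigmaPoch s η ε y / sigmaPoch s η (α + η - ε) y))) := fun β γ δ ε => by
    rw [sigmaWeight]
    ring
  rw [split β, split (β + j * η)]
  have := congrArg₂ (· * ·) (congrArg₂ (· * ·) eβ eγ) (congrArg₂ (· * ·) eδ eε)
  linear_combination s (α + 2 * y * η) / s α * ((sigmaPoch s η α y * sigmaPoch s η ν y) /
        (sigmaPoch s η η y * sigmaPoch s η (α + η - ν) y)) * this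

/-- Absorbing the brackets raises the parameter sum by `2(n - 1)η`, turning the coefficient `N + 3 -
2n` into the `N + 1` of the Frenkel–Turaev condition. In the result only the last two factors mix
`j` and `k`. -/
theorem sum_entry {η α β γ δ ε : ℂ} {n N j k : ℕ} (hn : n ≤ N + 1) (hj : j < n) (hk : k < n)
    (hα : ∀ k : ℤ, s (α + k * η) ≠ 0) (hβ : ∀ k : ℤ, s (α - β + k * η) ≠ 0)
    (hγ : ∀ k : ℤ, s (α - γ + k * η) ≠ 0) (hδ : ∀ k : ℤ, s (α - δ + k * η) ≠ 0)
    (hε : ∀ k : ℤ, s (α - ε + k * η) ≠ 0) (hη : sigmaPoch s η η N ≠ 0)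
    (hbal : β + γ + δ + ε = (N + 3 - 2 * n) * η + 2 * α) :
    ∑ y ∈ Finset.range (N + 1),
      ((∏ m ∈ Finset.range j, sigmaBracket s (β - α / 2 + m * η) (α / 2 + y * η)) *
        ∏ m ∈ Finset.range (n - 1 - j), sigmaBracket s (γ - α / 2 + m * η) (α / 2 + y * η)) *
      (((∏ m ∈ Finset.range k, sigmaBracket s (δ - α / 2 + m * η) (α / 2 + y * η)) *
        ∏ m ∈ Finset.range (n - 1 - k), sigmaBracket s (ε - α / 2 + m * η) (α / 2 + y * η)) *
        sigmaWeight s η α β γ δ ε (-N * η) y) =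
      ((sigmaPoch s η β j / sigmaPoch s η (α + η - β) (N - j)) *
        (sigmaPoch s η γ (n - 1 - j) / sigmaPoch s η (α + η - γ) (N - (n - 1 - j)))) *
      (((sigmaPoch s η δ k / sigmaPoch s η (α + η - δ) (N - k)) *
        (sigmaPoch s η ε (n - 1 - k) / sigmaPoch s η (α + η - ε) (N - (n - 1 - k)))) *
      (sigmaPoch s η (α + η) N * sigmaPoch s η (α + η - β - γ - (n - 1) * η) N *
        (sigmaPoch s η (α + η - β - δ - j * η - k * η) N *
          sigmaPoch s η (α + η - β - ε - j * η - (n - 1 - k : ℕ) * η) N))) := by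
  obtain ⟨j', hj'⟩ : ∃ j', n - 1 - j = j' := ⟨_, rfl⟩
  obtain ⟨k', hk'⟩ : ∃ k', n - 1 - k = k' := ⟨_, rfl⟩
  have hjc : (n : ℂ) = 1 + j + j' := by rw [show n = 1 + j + j' by omega]; push_cast; ring
  have hkc : (n : ℂ) = 1 + k + k' := by rw [show n = 1 + k + k' by omega]; push_cast; ring
  have shift : ∀ {u : ℂ} (i : ℕ), (∀ k : ℤ, s (α - u + k * η) ≠ 0) →
      ∀ k : ℤ, s (α - (u + i * η) + k * η) ≠ 0 := fun i h k =>
    sigma_ne_zero_of_int h (k - i) (by push_cast; ring)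
  have nz : ∀ {u : ℂ} (i : ℕ), (∀ k : ℤ, s (α - u + k * η) ≠ 0) →
      sigmaPoch s η (α + η - (u + i * η)) N ≠ 0 := fun i h =>
    sigmaPoch_ne_zero_of_int h (1 - i) (by push_cast; ring) N
  rw [hj', hk', Finset.sum_congr rfl fun y _ =>
    sigmaWeight_mul_brackets hs (-N * η) j j' k k' y hβ hγ hδ hε, ← Finset.mul_sum,
    frenkelTuraev_generic' hs hα (shift j hβ) (shift j' hγ) (shift k hδ) (shift k' hε) hη
      (by linear_combination hbal - η * hjc - η * hkc),
    sigmaPoch_congr (show α + η - (β + j * η) - (γ + j' * η) =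
      α + η - β - γ - (n - 1) * η by linear_combination η * hjc),
    sigmaPoch_congr (show α + η - (β + j * η) - (δ + k * η) =
      α + η - β - δ - j * η - k * η by ring),
    sigmaPoch_congr (show α + η - (β + j * η) - (ε + k' * η) =
      α + η - β - ε - j * η - k' * η by ring)]
  have rβ := sigmaPoch_reflect_div hs (show j ≤ N by omega) (nz j hβ)
  have rγ := sigmaPoch_reflect_div hs (show j' ≤ N by omega) (nz j' hγ)
  have rδ := sigmaPoch_reflect_div hs (show k ≤ N by omega) (nz k hδ)
  have rε := sigmaPoch_reflect_div hs (show k' ≤ N by omega) (nz k' hε)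
  -- The exponents sum to `2(n - 1)`.
  have sign : (-1 : ℂ) ^ j * (-1) ^ j' * ((-1) ^ k * (-1) ^ k') = 1 := by
    rw [← pow_add, ← pow_add, show j + j' = k + k' by omega, neg_one_pow_mul_self]
  have := congrArg₂ (· * ·) (congrArg₂ (· * ·) rβ rγ) (congrArg₂ (· * ·) rδ rε)
  rw [show ((-1) ^ j / sigmaPoch s η (α + η - β) (N - j) *
      ((-1) ^ j' / sigmaPoch s η (α + η - γ) (N - j')) *
      ((-1) ^ k / sigmaPoch s η (α + η - δ) (N - k) *
      ((-1) ^ k' / sigmaPoch s η (α + η - ε) (N - k')))) =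
      ((-1 : ℂ) ^ j * (-1) ^ j' * ((-1) ^ k * (-1) ^ k')) *
      (1 / sigmaPoch s η (α + η - β) (N - j) *
      (1 / sigmaPoch s η (α + η - γ) (N - j')) *
      (1 / sigmaPoch s η (α + η - δ) (N - k) *
      (1 / sigmaPoch s η (α + η - ε) (N - k')))) by ring, sign, one_mul] at this
  linear_combination (sigmaPoch s η β j * sigmaPoch s η γ j' * sigmaPoch s η δ k *
    sigmaPoch s η ε k' * (sigmaPoch s η (α + η) N *
      sigmaPoch s η (α + η - β - γ - (n - 1) * η) N *
        (sigmaPoch s η (α + η - β - δ - j * η - k * η) N *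
          sigmaPoch s η (α + η - β - ε - j * η - k' * η) N))) * this

end

/-! ### The Selberg sum for generic parameters. -/

theorem prod_univ_prod_Ioi {n : ℕ} (F : ℕ → ℕ → ℂ) :
    ∏ i : Fin n, ∏ j ∈ Finset.Ioi i, F i j =
      ∏ i ∈ Finset.range n, ∏ m ∈ Finset.range (n - 1 - i), F i (i + 1 + m) := by
  rw [Finset.prod_range]
  refine Finset.prod_congr rfl fun i _ => ?_
  symm
  refine Finset.prod_bij (fun m hm => ⟨i + 1 + m, by have := Finset.mem_range.1 hm; omega⟩)
    ?_ ?_ ?_ ?_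
  · intro m _
    simp only [Finset.mem_Ioi, Fin.lt_def]
    omega
  · intro m _ m' _ h
    simpa using h
  · intro j hj
    have hj := Fin.lt_def.1 (Finset.mem_Ioi.1 hj)
    exact ⟨j - (i + 1), Finset.mem_range.2 (by omega), Fin.ext (by simp; omega)⟩
  · intro m _
    rfl

/-- For each `i`, the same `N` factors are cut into blocks of lengths `n - 1 - i`, `N + 1 - n` and
`i`, with the first one reflected. The outer blocks will cancel normalizations of the two initial
determinants, and the middle one appears in the answer. -/
theorem prod_sigmaPoch_row {s : ℂ → ℂ} (hs : ∀ x, s (-x) = -s x) (η u : ℂ) {n N : ℕ}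
    (hn : n ≤ N + 1) :
    sigmaPoch s η (u - (n - 1) * η) N ^ n =
      (∏ i ∈ Finset.range n, (-1) ^ i) *
      ((∏ i ∈ Finset.range n, sigmaPoch s η (η - u + i * η) (n - 1 - i)) *
      (∏ i ∈ Finset.range n, sigmaPoch s η (u - i * η) (N + 1 - n)) *
      ∏ i ∈ Finset.range n, sigmaPoch s η (u + (N + 2 - 2 * n) * η + i * η) (n - 1 - i)) := by
  rw [← Finset.prod_range_reflect (fun i => (-1 : ℂ) ^ i),
    ← Finset.prod_range_reflect
      (fun i => sigmaPoch s η (u + (N + 2 - 2 * n) * η + i * η) (n - 1 - i)),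
    ← Finset.prod_mul_distrib, ← Finset.prod_mul_distrib, ← Finset.prod_mul_distrib]
  rw [Finset.prod_congr (g := fun _ => sigmaPoch s η (u - (n - 1) * η) N) rfl, Finset.prod_const,
    Finset.card_range]
  intro i hi
  have hi := Finset.mem_range.1 hi
  obtain ⟨l, rfl⟩ : ∃ l, n = i + 1 + l := Nat.exists_eq_add_of_le hi
  obtain ⟨M, rfl⟩ : ∃ M, N = i + l + M := Nat.exists_eq_add_of_le (by omega)
  rw [show i + 1 + l - 1 - i = l by omega, show i + l + M + 1 - (i + 1 + l) = M by omega,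
    show i + 1 + l - 1 - l = i by omega, show i + l + M = l + M + i by ring, sigmaPoch_add,
    sigmaPoch_add, sigmaPoch_reflect hs η (η - u + i * η)]
  push_cast
  rw [sigmaPoch_congr (show -(η - u + i * η) - l * η + η = u - (i + 1 + l - 1) * η by ring),
    sigmaPoch_congr (show u - (i + 1 + l - 1) * η + l * η = u - i * η by ring),
    sigmaPoch_congr (show u + (l + M + i + 2 - 2 * (i + 1 + l)) * η + l * η =
      u - (i + 1 + l - 1) * η + (l + M) * η by ring)]
  linear_combination sigmaPoch s η (u - (i + 1 + l - 1) * η) l * sigmaPoch s η (u - i * η) M *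
    sigmaPoch s η (u - (i + 1 + l - 1) * η + (l + M) * η) i * neg_one_pow_mul_self l

theorem prod_sigmaPoch_neg {s : ℂ → ℂ} (hs : ∀ x, s (-x) = -s x) (η : ℂ) (n N : ℕ) :
    ∏ i ∈ Finset.range n, sigmaPoch s η ((N - n + 2) * η + i * η) (n - 1 - i) =
      (∏ i ∈ Finset.range n, (-1) ^ i) * ∏ i ∈ Finset.range n, sigmaPoch s η (-N * η) i := by
  rw [← Finset.prod_range_reflect, ← Finset.prod_mul_distrib]
  refine Finset.prod_congr rfl fun i hi => ?_
  have hi := Finset.mem_range.1 hi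
  obtain ⟨l, rfl⟩ : ∃ l, n = i + 1 + l := Nat.exists_eq_add_of_le hi
  rw [sigmaPoch_reflect hs η (-N * η), show i + 1 + l - 1 - i = l by omega,
    show i + 1 + l - 1 - l = i by omega, ← mul_assoc, neg_one_pow_mul_self, one_mul]
  push_cast
  congr 1
  ring

theorem prod_reflect_row (n : ℕ) (F : ℕ → ℂ) :
    ∏ i : Fin n, F (n - 1 - i) = ∏ i ∈ Finset.range n, F i := by
  rw [← Finset.prod_range_reflect, Finset.prod_range]

/-- Three uses of `det_prod_bracket`: two produce the squared Vandermonde on the left of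
Cauchy–Binet, the third evaluates the determinant of Frenkel–Turaev sums on the right. The last six
hypotheses keep the base brackets and the normalization `C1 * C2` away from zero. -/
theorem sigma_selberg_generic {s : ℂ → ℂ} (hs : IsWeierstrassSigma s) {η α β γ δ ε : ℂ} {n N : ℕ}
    (hn : n ≤ N + 1) (hη : sigmaPoch s η η N ≠ 0)
    (hbal : β + γ + δ + ε = (N + 3 - 2 * n) * η + 2 * α)
    (hα : ∀ k : ℤ, s (α + k * η) ≠ 0) (hβ : ∀ k : ℤ, s (α - β + k * η) ≠ 0)
    (hγ : ∀ k : ℤ, s (α - γ + k * η) ≠ 0) (hδ : ∀ k : ℤ, s (α - δ + k * η) ≠ 0)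
    (hε : ∀ k : ℤ, s (α - ε + k * η) ≠ 0) (hββ : ∀ k : ℤ, s (2 * β - α + k * η) ≠ 0)
    (hδδ : ∀ k : ℤ, s (2 * δ - α + k * η) ≠ 0) (hβγ : ∀ k : ℤ, s (γ + β - α + k * η) ≠ 0)
    (hδε : ∀ k : ℤ, s (ε + δ - α + k * η) ≠ 0) (hγβ : ∀ k : ℤ, s (γ - β + k * η) ≠ 0)
    (hεδ : ∀ k : ℤ, s (ε - δ + k * η) ≠ 0) :
    ∑ x ∈ increasingTuples n N,
        (∏ i : Fin n, ∏ j ∈ Finset.Ioi i,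
          (s (((x j : ℕ) - (x i : ℕ)) * η) * s (α + ((x i : ℕ) + (x j : ℕ)) * η)) ^ 2) *
        ∏ i : Fin n, sigmaWeight s η α β γ δ ε (-N * η) (x i) =
      sigmaPoch s η (α + η) N ^ n *
      ∏ j ∈ Finset.range n,
        (sigmaPoch s η η j * sigmaPoch s η β j * sigmaPoch s η γ j * sigmaPoch s η δ j *
            sigmaPoch s η ε j * sigmaPoch s η (-N * η) j) *
          (sigmaPoch s η (α + η - β - γ - j * η) (N + 1 - n) *
            sigmaPoch s η (α + η - β - δ - j * η) (N + 1 - n) *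
            sigmaPoch s η (α + η - β - ε - j * η) (N + 1 - n)) /
          (sigmaPoch s η (α + η - β) (N - j) * sigmaPoch s η (α + η - γ) (N - j) *
            sigmaPoch s η (α + η - δ) (N - j) * sigmaPoch s η (α + η - ε) (N - j)) := by
  obtain ⟨f, g, hfg⟩ := hs.exists_area
  have hfg : ∀ x y, sigmaBracket s x y = f x * g y - f y * g x := hfg
  have hη' : ∀ i j : ℕ, i < j → j < n → s ((i - j) * η) ≠ 0 := fun i j hij hj => by
    rw [show ((i : ℂ) - j) * η = -(η + (j - i - 1 : ℕ) * η) by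
      rw [Nat.cast_sub (by omega), Nat.cast_sub hij.le]; push_cast; ring, hs.odd]
    exact neg_ne_zero.2 (Finset.prod_ne_zero_iff.1 hη _ (Finset.mem_range.2 (by omega)))
  have pair : ∀ {u : ℂ}, (∀ k : ℤ, s (2 * u + k * η) ≠ 0) → ∀ i j : ℕ, i < j → j < n →
      sigmaBracket s (u + i * η) (u + j * η) ≠ 0 := fun {u} h i j hij hj => by
    refine mul_ne_zero (sigma_ne_zero_of_int h (i + j) (by push_cast; ring)) ?_
    rw [show u + i * η - (u + j * η) = (i - j) * η by ring]
    exact hη' i j hij hj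
  have D1 := fun x : Fin n → Fin (N + 1) => det_prod_bracket hfg (fun m => β - α / 2 + m * η)
    (fun m => γ - α / 2 + m * η) (fun i => α / 2 + (x i : ℕ) * η)
    (pair fun k => by rw [show 2 * (β - α / 2) + k * η = 2 * β - α + k * η by ring]; exact hββ k)
  have D2 := fun x : Fin n → Fin (N + 1) => det_prod_bracket hfg (fun m => δ - α / 2 + m * η)
    (fun m => ε - α / 2 + m * η) (fun i => α / 2 + (x i : ℕ) * η)
    (pair fun k => by rw [show 2 * (δ - α / 2) + k * η = 2 * δ - α + k * η by ring]; exact hδδ k)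
  -- The bases come from `sigmaPoch_split` with `A = α + η - β - δ - i * η` and `B = α + η - β - ε -
  -- i * η`. Their difference does not depend on the row `i`, so the row enters only through the
  -- evaluation point.
  have D3 := det_prod_bracket hfg
    (fun m => ((α + η - β - ε) - (α + η - β - δ) + (N - n + 2) * η) / 2 + m * η)
    (fun m => ((α + η - β - δ) - (α + η - β - ε) + (N - n + 2) * η) / 2 + m * η)
    (fun i : Fin n => ((α + η - β - δ - i * η) + (α + η - β - ε - i * η) + (N - n) * η) / 2)
    (pair fun k => by
      rw [show 2 * (((α + η - β - ε) - (α + η - β - δ) + (N - n + 2) * η) / 2) + k * η =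
        -(ε - δ + ((-(N - n + 2 + k) : ℤ) : ℂ) * η) by push_cast; ring, hs.odd]
      exact neg_ne_zero.2 (hεδ _))
  have cauchyBinet := sum_increasingTuples_det_mul_det (n := n) (N := N)
    (fun j y => (∏ m ∈ Finset.range j,
        sigmaBracket s (β - α / 2 + m * η) (α / 2 + (y : ℕ) * η)) *
      ∏ m ∈ Finset.range (n - 1 - j), sigmaBracket s (γ - α / 2 + m * η) (α / 2 + (y : ℕ) * η))
    (fun k y => ((∏ m ∈ Finset.range k,
        sigmaBracket s (δ - α / 2 + m * η) (α / 2 + (y : ℕ) * η)) *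
      ∏ m ∈ Finset.range (n - 1 - k), sigmaBracket s (ε - α / 2 + m * η) (α / 2 + (y : ℕ) * η)) *
      sigmaWeight s η α β γ δ ε (-N * η) y)
  obtain ⟨C1, hC1⟩ : ∃ C, (∏ i : Fin n, ∏ m ∈ Finset.range (n - 1 - i),
    sigmaBracket s (γ - α / 2 + m * η) (β - α / 2 + i * η)) = C := ⟨_, rfl⟩
  obtain ⟨C2, hC2⟩ : ∃ C, (∏ i : Fin n, ∏ m ∈ Finset.range (n - 1 - i),
    sigmaBracket s (ε - α / 2 + m * η) (δ - α / 2 + i * η)) = C := ⟨_, rfl⟩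
  simp only [hC1, hC2] at D1 D2
  have lhs : ∀ x ∈ increasingTuples n N,
      (Matrix.of fun i j : Fin n => (∏ m ∈ Finset.range j,
        sigmaBracket s (β - α / 2 + m * η) (α / 2 + (x i : ℕ) * η)) *
      ∏ m ∈ Finset.range (n - 1 - j),
        sigmaBracket s (γ - α / 2 + m * η) (α / 2 + (x i : ℕ) * η)).det *
      (Matrix.of fun i j : Fin n => ((∏ m ∈ Finset.range j,
        sigmaBracket s (δ - α / 2 + m * η) (α / 2 + (x i : ℕ) * η)) *
      ∏ m ∈ Finset.range (n - 1 - j),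
        sigmaBracket s (ε - α / 2 + m * η) (α / 2 + (x i : ℕ) * η)) *
      sigmaWeight s η α β γ δ ε (-N * η) (x i)).det =
      C1 * C2 * ((∏ i : Fin n, ∏ j ∈ Finset.Ioi i,
          (s (((x j : ℕ) - (x i : ℕ)) * η) * s (α + ((x i : ℕ) + (x j : ℕ)) * η)) ^ 2) *
        ∏ i : Fin n, sigmaWeight s η α β γ δ ε (-N * η) (x i)) := fun x _ => by
    have col := Matrix.det_mul_column (fun i => sigmaWeight s η α β γ δ ε (-N * η) (x i))
      (Matrix.of fun i j : Fin n => ((∏ m ∈ Finset.range j,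
        sigmaBracket s (δ - α / 2 + m * η) (α / 2 + (x i : ℕ) * η)) *
      ∏ m ∈ Finset.range (n - 1 - j),
        sigmaBracket s (ε - α / 2 + m * η) (α / 2 + (x i : ℕ) * η)))
    simp only [Matrix.of_apply] at col
    simp only [mul_comm _ (sigmaWeight s η α β γ δ ε (-N * η) _)]
    rw [col, D1, D2]
    have sq : (∏ i : Fin n, ∏ j ∈ Finset.Ioi i,
        sigmaBracket s (α / 2 + (x i : ℕ) * η) (α / 2 + (x j : ℕ) * η)) ^ 2 =
        ∏ i : Fin n, ∏ j ∈ Finset.Ioi i,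
          (s (((x j : ℕ) - (x i : ℕ)) * η) * s (α + ((x i : ℕ) + (x j : ℕ)) * η)) ^ 2 := by
      rw [← Finset.prod_pow]
      refine Finset.prod_congr rfl fun i _ => ?_
      rw [← Finset.prod_pow]
      refine Finset.prod_congr rfl fun j _ => ?_
      rw [sigmaBracket, show α / 2 + (x i : ℕ) * η + (α / 2 + (x j : ℕ) * η) =
        α + ((x i : ℕ) + (x j : ℕ)) * η by ring, show α / 2 + (x i : ℕ) * η -
        (α / 2 + (x j : ℕ) * η) = -(((x j : ℕ) - (x i : ℕ)) * η) by ring, hs.odd]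
      ring
    rw [← sq]
    ring
  rw [Finset.sum_congr rfl lhs, ← Finset.mul_sum] at cauchyBinet
  -- Factor out what depends on the row alone and on the column alone; what remains is the matrix of
  -- `D3`.
  have entries : (Matrix.of fun j k : Fin n => ∑ y : Fin (N + 1),
      ((∏ m ∈ Finset.range j, sigmaBracket s (β - α / 2 + m * η) (α / 2 + (y : ℕ) * η)) *
        ∏ m ∈ Finset.range (n - 1 - j),
          sigmaBracket s (γ - α / 2 + m * η) (α / 2 + (y : ℕ) * η)) *
      (((∏ m ∈ Finset.range k, sigmaBracket s (δ - α / 2 + m * η) (α / 2 + (y : ℕ) * η)) *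
        ∏ m ∈ Finset.range (n - 1 - k),
          sigmaBracket s (ε - α / 2 + m * η) (α / 2 + (y : ℕ) * η)) *
        sigmaWeight s η α β γ δ ε (-N * η) y)) =
      Matrix.of fun j k : Fin n =>
        ((sigmaPoch s η β j / sigmaPoch s η (α + η - β) (N - j)) *
          (sigmaPoch s η γ (n - 1 - j) / sigmaPoch s η (α + η - γ) (N - (n - 1 - j))) *
          (sigmaPoch s η (α + η) N * sigmaPoch s η (α + η - β - γ - (n - 1) * η) N) *
          ((-1) ^ (n - 1) * (sigmaPoch s η (α + η - β - δ - j * η) (N + 1 - n) *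
            sigmaPoch s η (α + η - β - ε - j * η) (N + 1 - n)))) *
        (Matrix.of fun j k : Fin n =>
          ((sigmaPoch s η δ k / sigmaPoch s η (α + η - δ) (N - k)) *
          (sigmaPoch s η ε (n - 1 - k) / sigmaPoch s η (α + η - ε) (N - (n - 1 - k)))) *
          (Matrix.of fun j k : Fin n => (∏ m ∈ Finset.range k, sigmaBracket s
            (((α + η - β - ε) - (α + η - β - δ) + (N - n + 2) * η) / 2 + m * η)
            (((α + η - β - δ - j * η) + (α + η - β - ε - j * η) + (N - n) * η) / 2)) *
            ∏ m ∈ Finset.range (n - 1 - k), sigmaBracket s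
            (((α + η - β - δ) - (α + η - β - ε) + (N - n + 2) * η) / 2 + m * η)
            (((α + η - β - δ - j * η) + (α + η - β - ε - j * η) + (N - n) * η) / 2)) j k) j k := by
    ext j k
    simp only [Matrix.of_apply]
    rw [Fin.sum_univ_eq_sum_range (fun y : ℕ =>
      ((∏ m ∈ Finset.range j, sigmaBracket s (β - α / 2 + m * η) (α / 2 + y * η)) *
        ∏ m ∈ Finset.range (n - 1 - j), sigmaBracket s (γ - α / 2 + m * η) (α / 2 + y * η)) *
      (((∏ m ∈ Finset.range k, sigmaBracket s (δ - α / 2 + m * η) (α / 2 + y * η)) *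
        ∏ m ∈ Finset.range (n - 1 - k), sigmaBracket s (ε - α / 2 + m * η) (α / 2 + y * η)) *
        sigmaWeight s η α β γ δ ε (-N * η) y)),
      sum_entry hs hn j.2 k.2 hα hβ hγ hδ hε hη hbal, sigmaPoch_split hs k.2 hn,
      show α + η - β - ε - j * η - (α + η - β - δ - j * η) =
        (α + η - β - ε) - (α + η - β - δ) by ring,
      show α + η - β - δ - j * η - (α + η - β - ε - j * η) =
        (α + η - β - δ) - (α + η - β - ε) by ring]
    ring
  have key := entries ▸ cauchyBinet
  rw [Matrix.det_mul_column, Matrix.det_mul_row, D3] at key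
  have hC : ∀ {u v w w' : ℂ} {C : ℂ}, (∏ i : Fin n, ∏ m ∈ Finset.range (n - 1 - i),
      sigmaBracket s (u + m * η) (v + i * η)) = C → u + v = w → u - v = w' →
      C = (∏ i ∈ Finset.range n, sigmaPoch s η (w + i * η) (n - 1 - i)) *
        ∏ i ∈ Finset.range n, sigmaPoch s η (w' - i * η) (n - 1 - i) := fun {u v w w' C} h h1 h2 => by
    rw [← h, ← Finset.prod_mul_distrib, Finset.prod_range]
    refine Finset.prod_congr rfl fun i _ => ?_
    rw [prod_sigmaBracket, ← h1, ← h2, sigmaPoch_congr (show u + (v + i * η) = u + v + i * η by ring),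
      sigmaPoch_congr (show u - (v + i * η) = u - v - i * η by ring)]
  have eC1 := hC hC1 (w := γ + β - α) (w' := γ - β) (by ring) (by ring)
  have eC2 := hC hC2 (w := ε + δ - α) (w' := ε - δ) (by ring) (by ring)
  have eC3 := hC (C := _) rfl
    (u := ((α + η - β - δ) - (α + η - β - ε) + (N - n + 2) * η) / 2)
    (v := ((α + η - β - ε) - (α + η - β - δ) + (N - n + 2) * η) / 2)
    (w := (N - n + 2) * η) (w' := ε - δ) (by ring) (by ring)
  -- Differences of the row points are multiples of `η`, and balancing rewrites their sums as `γ -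
  -- β` plus multiples of `η`. Hence the factors `sigmaPoch s η η i` of the answer and the `γ - β`
  -- part of `C1`.
  have eV : (∏ i : Fin n, ∏ j ∈ Finset.Ioi i, sigmaBracket s
      (((α + η - β - δ - i * η) + (α + η - β - ε - i * η) + (N - n) * η) / 2)
      (((α + η - β - δ - j * η) + (α + η - β - ε - j * η) + (N - n) * η) / 2)) =
      (∏ i ∈ Finset.range n, sigmaPoch s η (γ - β - i * η) (n - 1 - i)) *
        ∏ i ∈ Finset.range n, sigmaPoch s η η i := by
    rw [prod_univ_prod_Ioi (fun i j => sigmaBracket s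
      (((α + η - β - δ - i * η) + (α + η - β - ε - i * η) + (N - n) * η) / 2)
      (((α + η - β - δ - j * η) + (α + η - β - ε - j * η) + (N - n) * η) / 2)),
      ← Finset.prod_range_reflect (fun i => sigmaPoch s η η i), ← Finset.prod_mul_distrib]
    refine Finset.prod_congr rfl fun i hi => ?_
    have hi := Finset.mem_range.1 hi
    obtain ⟨l, rfl⟩ : ∃ l, n = i + 1 + l := Nat.exists_eq_add_of_le hi
    simp only [sigmaPoch, show i + 1 + l - 1 - i = l by omega]
    rw [← Finset.prod_range_reflect (fun m => s (γ - β - i * η + m * η)), ← Finset.prod_mul_distrib]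
    refine Finset.prod_congr rfl fun m hm => ?_
    have hm := Finset.mem_range.1 hm
    obtain ⟨r, rfl⟩ : ∃ r, l = m + 1 + r := Nat.exists_eq_add_of_le hm
    rw [sigmaBracket, show m + 1 + r - 1 - m = r by omega]
    push_cast at hbal ⊢
    congr 2
    · linear_combination -hbal
    · ring
  have toRange : ∀ F : ℕ → ℂ, ∏ i : Fin n, F i = ∏ i ∈ Finset.range n, F i := fun F =>
    (Finset.prod_range F).symm
  have ratio : ∀ u v : ℂ, (∏ i : Fin n, (sigmaPoch s η u i / sigmaPoch s η (α + η - u) (N - i)) *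
      (sigmaPoch s η v (n - 1 - i) / sigmaPoch s η (α + η - v) (N - (n - 1 - i)))) =
      (∏ i ∈ Finset.range n, sigmaPoch s η u i / sigmaPoch s η (α + η - u) (N - i)) *
      ∏ i ∈ Finset.range n, sigmaPoch s η v i / sigmaPoch s η (α + η - v) (N - i) := fun u v => by
    rw [Finset.prod_mul_distrib,
      toRange (fun i => sigmaPoch s η u i / sigmaPoch s η (α + η - u) (N - i)),
      prod_reflect_row n (fun i => sigmaPoch s η v i / sigmaPoch s η (α + η - v) (N - i))]
  have sign : ((-1 : ℂ) ^ (n - 1)) ^ n = 1 := by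
    rw [← pow_mul, mul_comm]
    exact (Nat.even_mul_pred_self n).neg_one_pow
  have sign' : (∏ i ∈ Finset.range n, (-1 : ℂ) ^ i) * ∏ i ∈ Finset.range n, (-1 : ℂ) ^ i = 1 := by
    rw [← Finset.prod_mul_distrib]
    exact Finset.prod_eq_one fun i _ => neg_one_pow_mul_self i
  -- The outer blocks become the `γ + β - α` part of `C1` and, by balancing, the `ε + δ - α` part of
  -- `C2`. Together with `eV` and the `ε - δ` part of `eC3` this accounts for all of `C1 * C2`.
  have row := prod_sigmaPoch_row hs.odd η (α + η - β - γ) hn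
  rw [Finset.prod_congr rfl fun (i : ℕ) _ => sigmaPoch_congr
      (show η - (α + η - β - γ) + i * η = γ + β - α + i * η by ring) (n - 1 - i),
    Finset.prod_congr rfl fun (i : ℕ) _ => sigmaPoch_congr
      (show α + η - β - γ + (N + 2 - 2 * n) * η + i * η = ε + δ - α + i * η by
        linear_combination -hbal) (n - 1 - i)] at row
  have nz : ∀ {u : ℂ}, (∀ k : ℤ, s (u + k * η) ≠ 0) →
      (∏ i ∈ Finset.range n, sigmaPoch s η (u + i * η) (n - 1 - i)) ≠ 0 := fun h =>
    Finset.prod_ne_zero_iff.2 fun i _ => sigmaPoch_ne_zero_of_int h i (by push_cast; ring) _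
  have nz' : ∀ {u : ℂ}, (∀ k : ℤ, s (u + k * η) ≠ 0) →
      (∏ i ∈ Finset.range n, sigmaPoch s η (u - i * η) (n - 1 - i)) ≠ 0 := fun h =>
    Finset.prod_ne_zero_iff.2 fun i _ => sigmaPoch_ne_zero_of_int h (-i) (by push_cast; ring) _
  have hne : C1 * C2 ≠ 0 := by
    rw [eC1, eC2]
    exact mul_ne_zero (mul_ne_zero (nz hβγ) (nz' hγβ)) (mul_ne_zero (nz hδε) (nz' hεδ))
  refine mul_left_cancel₀ hne (key.trans ?_)
  rw [eC3, eV, prod_sigmaPoch_neg hs.odd, ratio, Finset.prod_mul_distrib, Finset.prod_mul_distrib,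
    ratio, Finset.prod_mul_distrib,
    Finset.prod_mul_distrib (f := fun _ : Fin n => (-1 : ℂ) ^ (n - 1)), Finset.prod_const,
    Finset.prod_const, Finset.prod_const, Finset.card_univ, Fintype.card_fin, sign, row, toRange fun i : ℕ =>
      sigmaPoch s η (α + η - β - δ - i * η) (N + 1 - n) *
        sigmaPoch s η (α + η - β - ε - i * η) (N + 1 - n), eC1, eC2]
  simp only [Finset.prod_mul_distrib, Finset.prod_div_distrib]
  refine Eq.symm ((one_mul _).symm.trans ((congrArg (· * _) sign'.symm).trans ?_))
  ring

/-! ### Removal of the genericity assumptions. -/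

theorem continuous_sigmaPoch {s : ℂ → ℂ} (hs : Continuous s) (η : ℂ) {u : ℂ → ℂ}
    (hu : Continuous u) (k : ℕ) : Continuous fun t => sigmaPoch s η (u t) k := by
  unfold sigmaPoch
  fun_prop

/-- A nonconstant affine line meets a countable zero set in countably many parameters, even after
all integer shifts by `η`. -/
theorem countable_zeros_along_line {s : ℂ → ℂ} (hz : {u | s u = 0}.Countable) (η u : ℂ) {c : ℂ}
    (hc : c ≠ 0) : {t : ℂ | ¬ ∀ k : ℤ, s (u + c * t + k * η) ≠ 0}.Countable := by
  have : {t : ℂ | ¬ ∀ k : ℤ, s (u + c * t + k * η) ≠ 0} =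
      ⋃ k : ℤ, (fun t => u + c * t + k * η) ⁻¹' {u | s u = 0} := by
    ext t
    simp
  rw [this]
  refine Set.countable_iUnion fun k => hz.preimage fun x y h => ?_
  exact mul_left_cancel₀ hc (by linear_combination h)

theorem continuousAt_sigmaWeight {s : ℂ → ℂ} (hs : Continuous s) {η ν : ℂ}
    {α β γ δ ε : ℂ → ℂ} (hα : Continuous α) (hβ : Continuous β) (hγ : Continuous γ)
    (hδ : Continuous δ) (hε : Continuous ε) {t : ℂ} {k : ℕ} (h0 : s (α t) ≠ 0)
    (hη : sigmaPoch s η η k ≠ 0) (h1 : sigmaPoch s η (α t + η - β t) k ≠ 0)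
    (h2 : sigmaPoch s η (α t + η - γ t) k ≠ 0) (h3 : sigmaPoch s η (α t + η - δ t) k ≠ 0)
    (h4 : sigmaPoch s η (α t + η - ε t) k ≠ 0) (h5 : sigmaPoch s η (α t + η - ν) k ≠ 0) :
    ContinuousAt (fun t => sigmaWeight s η (α t) (β t) (γ t) (δ t) (ε t) ν k) t := by
  unfold sigmaWeight
  refine ContinuousAt.mul (ContinuousAt.div ?_ ?_ h0) (ContinuousAt.div ?_ ?_ ?_)
  · exact Continuous.continuousAt (by fun_prop)
  · exact Continuous.continuousAt (by fun_prop)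
  · exact Continuous.continuousAt (((((((continuous_sigmaPoch hs η hα k).mul
      (continuous_sigmaPoch hs η hβ k)).mul (continuous_sigmaPoch hs η hγ k)).mul
      (continuous_sigmaPoch hs η hδ k)).mul (continuous_sigmaPoch hs η hε k)).mul
      continuous_const))
  · exact Continuous.continuousAt ((((((continuous_const.mul
      (continuous_sigmaPoch hs η (by fun_prop) k)).mul
      (continuous_sigmaPoch hs η (by fun_prop) k)).mul
      (continuous_sigmaPoch hs η (by fun_prop) k)).mul
      (continuous_sigmaPoch hs η (by fun_prop) k)).mul
      (continuous_sigmaPoch hs η (by fun_prop) k)))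
  · simp only [mul_ne_zero_iff]
    exact ⟨⟨⟨⟨⟨hη, h1⟩, h2⟩, h3⟩, h4⟩, h5⟩

/-- The discrete elliptic Selberg sum in additive notation. -/
theorem sigma_selberg {s : ℂ → ℂ} (hs : IsWeierstrassSigma s) (hc : Continuous s)
    (hz : {u | s u = 0}.Countable) {η α β γ δ ε : ℂ} {n N : ℕ} (hn : n ≤ N + 1)
    (hbal : β + γ + δ + ε = (N + 3 - 2 * n) * η + 2 * α) (h0 : s α ≠ 0)
    (hη : sigmaPoch s η η N ≠ 0) (h1 : sigmaPoch s η (α + η - β) N ≠ 0)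
    (h2 : sigmaPoch s η (α + η - γ) N ≠ 0) (h3 : sigmaPoch s η (α + η - δ) N ≠ 0)
    (h4 : sigmaPoch s η (α + η - ε) N ≠ 0) (h5 : sigmaPoch s η (α + η - -N * η) N ≠ 0) :
    ∑ x ∈ increasingTuples n N,
        (∏ i : Fin n, ∏ j ∈ Finset.Ioi i,
          (s (((x j : ℕ) - (x i : ℕ)) * η) * s (α + ((x i : ℕ) + (x j : ℕ)) * η)) ^ 2) *
        ∏ i : Fin n, sigmaWeight s η α β γ δ ε (-N * η) (x i) =
      sigmaPoch s η (α + η) N ^ n *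
      ∏ j ∈ Finset.range n,
        (sigmaPoch s η η j * sigmaPoch s η β j * sigmaPoch s η γ j * sigmaPoch s η δ j *
            sigmaPoch s η ε j * sigmaPoch s η (-N * η) j) *
          (sigmaPoch s η (α + η - β - γ - j * η) (N + 1 - n) *
            sigmaPoch s η (α + η - β - δ - j * η) (N + 1 - n) *
            sigmaPoch s η (α + η - β - ε - j * η) (N + 1 - n)) /
          (sigmaPoch s η (α + η - β) (N - j) * sigmaPoch s η (α + η - γ) (N - j) *
            sigmaPoch s η (α + η - δ) (N - j) * sigmaPoch s η (α + η - ε) (N - j)) := by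
  have bad := fun (u c : ℂ) (h : c ≠ 0) => countable_zeros_along_line hz η u h
  -- The direction `(1, 2, 3, 5, -8)` preserves balancing, since `2 + 3 + 5 - 8 = 2 * 1`, and gives
  -- each of the eleven linear forms a nonzero slope. The excluded parameters are thus countable,
  -- and good ones accumulate at `0`.
  have good := ((((((((((bad α 1 (by norm_num)).union (bad (α - β) (-1) (by norm_num))).union
    (bad (α - γ) (-2) (by norm_num))).union (bad (α - δ) (-4) (by norm_num))).union
    (bad (α - ε) 9 (by norm_num))).union (bad (2 * β - α) 3 (by norm_num))).union
    (bad (2 * δ - α) 9 (by norm_num))).union (bad (γ + β - α) 4 (by norm_num))).union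
    (bad (ε + δ - α) (-4) (by norm_num))).union ((bad (γ - β) 1 (by norm_num)).union
    (bad (ε - δ) (-13) (by norm_num)))).dense_compl ℂ
  have freq := mem_closure_iff_frequently.1 (good 0)
  have ne : ∀ {u : ℂ} {t : ℂ} (v : ℂ) (c : ℂ), (∀ k : ℤ, s (v + c * t + k * η) ≠ 0) →
      u = v + c * t → ∀ k : ℤ, s (u + k * η) ≠ 0 := fun v c h e k => e ▸ h k
  have heq := freq.mono fun t ht => by
    simp only [Set.mem_compl_iff, Set.mem_union, Set.mem_ofPred_eq, not_or, not_not] at ht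
    obtain ⟨⟨⟨⟨⟨⟨⟨⟨⟨gα, gβ⟩, gγ⟩, gδ⟩, gε⟩, gββ⟩, gδδ⟩, gβγ⟩, gδε⟩, gγβ, gεδ⟩ := ht
    exact sigma_selberg_generic hs (α := α + t) (β := β + 2 * t) (γ := γ + 3 * t)
      (δ := δ + 5 * t) (ε := ε - 8 * t) hn hη (by linear_combination hbal)
      (ne _ _ gα (by ring)) (ne _ _ gβ (by ring)) (ne _ _ gγ (by ring)) (ne _ _ gδ (by ring))
      (ne _ _ gε (by ring)) (ne _ _ gββ (by ring)) (ne _ _ gδδ (by ring)) (ne _ _ gβγ (by ring))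
      (ne _ _ gδε (by ring)) (ne _ _ gγβ (by ring)) (ne _ _ gεδ (by ring))
  have lhs : ContinuousAt (fun t => ∑ x ∈ increasingTuples n N,
      (∏ i : Fin n, ∏ j ∈ Finset.Ioi i,
        (s (((x j : ℕ) - (x i : ℕ)) * η) * s (α + t + ((x i : ℕ) + (x j : ℕ)) * η)) ^ 2) *
      ∏ i : Fin n, sigmaWeight s η (α + t) (β + 2 * t) (γ + 3 * t) (δ + 5 * t) (ε - 8 * t)
        (-N * η) (x i)) 0 := by
    refine tendsto_finsetSum _ fun x _ => Filter.Tendsto.mul ?_ (tendsto_finsetProd _ fun i _ => ?_)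
    · exact Continuous.tendsto (by fun_prop) 0
    · have hi : (x i : ℕ) ≤ N := by omega
      refine continuousAt_sigmaWeight hc (by fun_prop) (by fun_prop) (by fun_prop) (by fun_prop)
        (by fun_prop) ?_ (sigmaPoch_ne_zero_of_le hη hi) ?_ ?_ ?_ ?_ ?_ <;>
      simp only [add_zero, mul_zero, sub_zero]
      exacts [h0, sigmaPoch_ne_zero_of_le h1 hi, sigmaPoch_ne_zero_of_le h2 hi,
        sigmaPoch_ne_zero_of_le h3 hi, sigmaPoch_ne_zero_of_le h4 hi,
        sigmaPoch_ne_zero_of_le h5 hi]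
  have rhs : ContinuousAt (fun t => sigmaPoch s η (α + t + η) N ^ n *
      ∏ j ∈ Finset.range n,
        (sigmaPoch s η η j * sigmaPoch s η (β + 2 * t) j * sigmaPoch s η (γ + 3 * t) j *
            sigmaPoch s η (δ + 5 * t) j * sigmaPoch s η (ε - 8 * t) j *
            sigmaPoch s η (-N * η) j) *
          (sigmaPoch s η (α + t + η - (β + 2 * t) - (γ + 3 * t) - j * η) (N + 1 - n) *
            sigmaPoch s η (α + t + η - (β + 2 * t) - (δ + 5 * t) - j * η) (N + 1 - n) *
            sigmaPoch s η (α + t + η - (β + 2 * t) - (ε - 8 * t) - j * η) (N + 1 - n)) /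
          (sigmaPoch s η (α + t + η - (β + 2 * t)) (N - j) *
            sigmaPoch s η (α + t + η - (γ + 3 * t)) (N - j) *
            sigmaPoch s η (α + t + η - (δ + 5 * t)) (N - j) *
            sigmaPoch s η (α + t + η - (ε - 8 * t)) (N - j))) 0 := by
    refine ContinuousAt.mul (Continuous.continuousAt
      ((continuous_sigmaPoch hc η (by fun_prop) N).pow n)) (tendsto_finsetProd _ fun j _ =>
      ContinuousAt.div (Continuous.continuousAt ?_) (Continuous.continuousAt ?_) ?_)
    · unfold sigmaPoch; fun_prop
    · unfold sigmaPoch; fun_prop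
    · simp only [add_zero, mul_zero, sub_zero, mul_ne_zero_iff]
      have hj := Nat.sub_le N j
      exact ⟨⟨⟨sigmaPoch_ne_zero_of_le h1 hj, sigmaPoch_ne_zero_of_le h2 hj⟩,
        sigmaPoch_ne_zero_of_le h3 hj⟩, sigmaPoch_ne_zero_of_le h4 hj⟩
  simpa using tendsto_nhds_unique_of_frequently_eq lhs rhs heq

/-! ### The Jacobi triple product and basic properties of theta. -/

/-- `(p; p)_k = ∏_{i < k} (1 - p ^ (i + 1))`. -/
def qFactorial (p : ℂ) (k : ℕ) : ℂ :=
  ∏ i ∈ Finset.range k, (1 - p ^ (i + 1))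

/-- `1 / (p; p)_k`, extended by zero to negative integers. -/
noncomputable def invQFactorial (p : ℂ) (k : ℤ) : ℂ :=
  if 0 ≤ k then (qFactorial p k.toNat)⁻¹ else 0

/-- The coefficients `(-1) ^ k p ^ (k (k - 1) / 2)` of the theta series. -/
noncomputable def thetaCoeff (p : ℂ) (k : ℤ) : ℂ :=
  (-1) ^ k * p ^ (k * (k - 1) / 2)

theorem two_mul_triangle (k : ℤ) : 2 * (k * (k - 1) / 2) = k * (k - 1) :=
  Int.mul_ediv_cancel' (Int.even_mul_pred_self k).two_dvd

section

variable {p : ℂ}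

theorem one_sub_pow_ne_zero (hp : ‖p‖ < 1) (i : ℕ) : 1 - p ^ (i + 1) ≠ 0 := by
  intro h
  have : ‖p‖ ^ (i + 1) = 1 := by rw [← norm_pow, ← sub_eq_zero.1 h, norm_one]
  exact absurd this (pow_lt_one₀ (norm_nonneg p) hp (by omega)).ne

theorem qFactorial_ne_zero (hp : ‖p‖ < 1) (k : ℕ) : qFactorial p k ≠ 0 :=
  Finset.prod_ne_zero_iff.2 fun i _ => one_sub_pow_ne_zero hp i

theorem qFactorial_succ (k : ℕ) : qFactorial p (k + 1) = qFactorial p k * (1 - p ^ (k + 1)) :=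
  Finset.prod_range_succ _ _

/-- Extension by zero makes the recurrence hold for every integer: at `k = 0` the factor `1 - p ^ 0`
vanishes. -/
theorem invQFactorial_sub_one (hp : ‖p‖ < 1) (k : ℤ) :
    invQFactorial p (k - 1) = (1 - p ^ k) * invQFactorial p k := by
  rcases lt_trichotomy k 0 with h | rfl | h
  · rw [invQFactorial, invQFactorial, if_neg (by omega), if_neg (by omega), mul_zero]
  · simp [invQFactorial]
  · obtain ⟨m, rfl⟩ : ∃ m : ℕ, k = m + 1 := ⟨(k - 1).toNat, by omega⟩
    have h1 := one_sub_pow_ne_zero hp m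
    have h2 := qFactorial_ne_zero hp m
    rw [invQFactorial, invQFactorial, if_pos (by omega), if_pos (by omega),
      show ((m : ℤ) + 1 - 1).toNat = m by omega, show ((m : ℤ) + 1).toNat = m + 1 by omega,
      qFactorial_succ, show p ^ ((m : ℤ) + 1) = p ^ (m + 1) by norm_cast]
    field_simp

theorem thetaCoeff_succ (hp0 : p ≠ 0) (k : ℤ) :
    thetaCoeff p (k + 1) = -(p ^ k * thetaCoeff p k) := by
  have h : (k + 1) * (k + 1 - 1) / 2 = k + k * (k - 1) / 2 := by
    have h1 := two_mul_triangle k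
    have h2 := two_mul_triangle (k + 1)
    linarith
  rw [thetaCoeff, thetaCoeff, h, zpow_add₀ hp0, zpow_add₀ (by norm_num : (-1 : ℂ) ≠ 0)]
  simp
  ring

/-- The finite form of the Jacobi triple product. -/
theorem hasSum_finite_tripleProduct (hp : ‖p‖ < 1) (hp0 : p ≠ 0) {z : ℂ} (hz : z ≠ 0) (m : ℕ) :
    HasSum (fun k : ℤ => qFactorial p (2 * m) * invQFactorial p (m + k) * invQFactorial p (m - k) *
        (thetaCoeff p k * z ^ k))
      (∏ j ∈ Finset.range m, (1 - p ^ j * z) * (1 - p ^ (j + 1) / z)) := by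
  induction m with
  | zero =>
    have h := hasSum_single (f := fun k : ℤ => qFactorial p (2 * 0) *
      invQFactorial p ((0 : ℕ) + k) * invQFactorial p ((0 : ℕ) - k) * (thetaCoeff p k * z ^ k)) 0
      (fun k hk => by
        rcases lt_or_gt_of_ne hk with h | h
        · simp [invQFactorial, not_le.2 h]
        · simp [invQFactorial, not_le.2 h])
    simpa [invQFactorial, qFactorial, thetaCoeff] using h
  | succ m ih =>
    rw [Finset.prod_range_succ]
    -- The new factor expands as `1 + p ^ (2m + 1) - p ^ m z - p ^ (m + 1) / z`, so the new series
    -- is a combination of the old one and its two unit shifts.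
    have h1 := ih.mul_left (1 + p ^ (2 * m + 1))
    have h2 := ((Equiv.subRight (1 : ℤ)).hasSum_iff.2 ih).mul_left (-(p ^ m * z))
    have h3 := ((Equiv.addRight (1 : ℤ)).hasSum_iff.2 ih).mul_left (-(p ^ (m + 1) / z))
    have h := (h1.add h2).add h3
    rw [show (1 + p ^ (2 * m + 1)) * ∏ j ∈ Finset.range m, (1 - p ^ j * z) * (1 - p ^ (j + 1) / z) +
        -(p ^ m * z) * ∏ j ∈ Finset.range m, (1 - p ^ j * z) * (1 - p ^ (j + 1) / z) +
        -(p ^ (m + 1) / z) * ∏ j ∈ Finset.range m, (1 - p ^ j * z) * (1 - p ^ (j + 1) / z) =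
        (∏ j ∈ Finset.range m, (1 - p ^ j * z) * (1 - p ^ (j + 1) / z)) *
          ((1 - p ^ m * z) * (1 - p ^ (m + 1) / z)) by field_simp; ring_nf] at h
    refine Eq.subst (motive := fun f => HasSum f _) (funext fun k => ?_) h
    · simp only [Function.comp, Equiv.subRight_apply, Equiv.coe_addRight]
      have g1 := invQFactorial_sub_one hp (m + 1 + k)
      have g1' := invQFactorial_sub_one hp (m + k)
      have g2 := invQFactorial_sub_one hp (m + 1 - k)
      have g2' := invQFactorial_sub_one hp (m - k)
      rw [show (m : ℤ) + 1 + k - 1 = m + k by ring] at g1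
      rw [show (m : ℤ) + 1 - k - 1 = m - k by ring] at g2
      have t1 := thetaCoeff_succ hp0 k
      have t2 := thetaCoeff_succ hp0 (k - 1)
      rw [sub_add_cancel] at t2
      have t2' : thetaCoeff p (k - 1) = -(p * (p ^ k)⁻¹ * thetaCoeff p k) := by
        rw [t2, zpow_sub₀ hp0, zpow_one]
        field_simp
      rw [show ((m + 1 : ℕ) : ℤ) + k = m + 1 + k by push_cast; ring,
        show ((m + 1 : ℕ) : ℤ) - k = m + 1 - k by push_cast; ring,
        show (m : ℤ) + (k - 1) = m + k - 1 by ring, show (m : ℤ) - (k - 1) = m + 1 - k by ring,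
        show (m : ℤ) + (k + 1) = m + 1 + k by ring, show (m : ℤ) - (k + 1) = m - k - 1 by ring,
        g1', g2', g1, g2, t1, t2', show 2 * (m + 1) = 2 * m + 1 + 1 by ring, qFactorial_succ,
        qFactorial_succ]
      have hk : p ^ k ≠ 0 := zpow_ne_zero _ hp0
      simp only [zpow_add₀ hp0, zpow_sub₀ hp0, zpow_add₀ hz, zpow_sub₀ hz, zpow_natCast, zpow_one]
      generalize p ^ k = w at *
      field_simp
      ring

theorem summable_norm_thetaCoeff (hp : ‖p‖ < 1) (hp0 : p ≠ 0) {z : ℂ} (hz : z ≠ 0) :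
    Summable fun k : ℤ => ‖thetaCoeff p k * z ^ k‖ := by
  have ht : ∀ k, thetaCoeff p k ≠ 0 := fun k =>
    mul_ne_zero (zpow_ne_zero _ (by norm_num)) (zpow_ne_zero _ hp0)
  have lim := tendsto_pow_atTop_nhds_zero_of_lt_one (norm_nonneg p) hp
  refine Summable.of_nat_of_neg ?_ ?_
  · refine summable_of_ratio_test_tendsto_lt_one zero_lt_one
      (Filter.Eventually.of_forall fun n => ?_) (l := 0) ?_ |>.of_norm
    · simp [ht, hz]
    · have := lim.mul_const ‖z‖
      rw [zero_mul] at this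
      refine this.congr fun n => ?_
      have h : ‖thetaCoeff p n‖ ≠ 0 := norm_ne_zero_iff.2 (ht n)
      have h' : ‖z‖ ≠ 0 := norm_ne_zero_iff.2 hz
      push_cast
      rw [thetaCoeff_succ hp0, zpow_add₀ hz]
      simp
      field_simp
  · refine summable_of_ratio_test_tendsto_lt_one zero_lt_one
      (Filter.Eventually.of_forall fun n => ?_) (l := 0) ?_ |>.of_norm
    · simp [ht, hz]
    · have := (lim.comp (Filter.tendsto_add_atTop_nat 1)).mul_const ‖z‖⁻¹
      rw [zero_mul] at this
      refine this.congr fun n => ?_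
      have h : ‖thetaCoeff p (-(n + 1 : ℕ))‖ ≠ 0 := norm_ne_zero_iff.2 (ht _)
      have h' : ‖z‖ ≠ 0 := norm_ne_zero_iff.2 hz
      have hp' : ‖p‖ ≠ 0 := norm_ne_zero_iff.2 hp0
      have e := thetaCoeff_succ hp0 (-(n + 1 : ℕ))
      rw [show -((n + 1 : ℕ) : ℤ) + 1 = -n by push_cast; ring] at e
      rw [e]
      simp only [Function.comp, norm_mul, norm_neg, zpow_neg, zpow_natCast, norm_norm,
        norm_pow, norm_inv]
      field_simp
      ring

end

section

variable {p : ℂ}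

theorem exists_tendsto_qFactorial (hp : ‖p‖ < 1) :
    ∃ l : ℂ, l ≠ 0 ∧ Filter.Tendsto (qFactorial p) Filter.atTop (nhds l) := by
  have hs : Summable fun i : ℕ => ‖-p ^ (i + 1)‖ := by
    simpa [pow_succ] using (summable_geometric_of_lt_one (norm_nonneg p) hp).mul_right ‖p‖
  refine ⟨∏' i : ℕ, (1 + -p ^ (i + 1)), tprod_one_add_ne_zero_of_summable (fun i => ?_) hs, ?_⟩
  · rw [← sub_eq_add_neg]
    exact one_sub_pow_ne_zero hp i
  · have e : qFactorial p = fun k => ∏ i ∈ Finset.range k, (1 + -p ^ (i + 1)) := by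
      funext k
      simp only [qFactorial, sub_eq_add_neg]
    rw [e]
    exact (multipliable_one_add_of_summable hs).hasProd.tendsto_prod_nat

/-- The theta function is a constant multiple of the series `∑ (-1) ^ k p ^ (k (k - 1) / 2) z ^ k`. -/
theorem exists_ellTheta_eq_tsum (hp : ‖p‖ < 1) (hp0 : p ≠ 0) :
    ∃ c : ℂ, ∀ z : ℂ, z ≠ 0 → ellTheta p z = c * ∑' k : ℤ, thetaCoeff p k * z ^ k := by
  obtain ⟨l, hl0, hl⟩ := exists_tendsto_qFactorial hp
  refine ⟨l⁻¹, fun z hz => ?_⟩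
  have hinv : Filter.Tendsto (invQFactorial p) Filter.atTop (nhds l⁻¹) := by
    have h1 : Filter.Tendsto Int.toNat Filter.atTop Filter.atTop :=
      Filter.tendsto_atTop.2 fun b => (Filter.eventually_ge_atTop (b : ℤ)).mono fun k hk => by omega
    refine ((hl.inv₀ hl0).comp h1).congr' ((Filter.eventually_ge_atTop 0).mono fun k hk => ?_)
    simp [invQFactorial, hk]
  obtain ⟨B, hB⟩ := hl.norm.isBoundedUnder_le.bddAbove_range
  obtain ⟨B', hB'⟩ := (hl.inv₀ hl0).norm.isBoundedUnder_le.bddAbove_range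
  have hB : ∀ k, ‖qFactorial p k‖ ≤ B := fun k => hB ⟨k, rfl⟩
  have hB'' : ∀ k, ‖invQFactorial p k‖ ≤ max B' 0 := fun k => by
    rw [invQFactorial]
    split_ifs
    · exact (hB' ⟨_, rfl⟩).trans (le_max_left _ _)
    · simp
  -- The limit `m → ∞` of the finite triple product; bounded `q`-factorials leave the absolutely
  -- convergent theta series as a majorant.
  have lim := tendsto_tsum_of_dominated_convergence (𝓕 := Filter.atTop)
    (f := fun (m : ℕ) (k : ℤ) => qFactorial p (2 * m) * invQFactorial p (m + k) *
      invQFactorial p (m - k) * (thetaCoeff p k * z ^ k))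
    (g := fun k => l * l⁻¹ * l⁻¹ * (thetaCoeff p k * z ^ k))
    (bound := fun k => B * max B' 0 * max B' 0 * ‖thetaCoeff p k * z ^ k‖)
    ((summable_norm_thetaCoeff hp hp0 hz).mul_left _)
    (fun k => by
      have c1 : Filter.Tendsto (fun m : ℕ => 2 * m) Filter.atTop Filter.atTop :=
        Filter.tendsto_id.const_mul_atTop' (by norm_num)
      have c2 : Filter.Tendsto (fun m : ℕ => (m : ℤ) + k) Filter.atTop Filter.atTop :=
        Filter.tendsto_atTop_add_const_right _ _ tendsto_natCast_atTop_atTop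
      have c3 : Filter.Tendsto (fun m : ℕ => (m : ℤ) - k) Filter.atTop Filter.atTop :=
        Filter.tendsto_atTop_add_const_right _ _ tendsto_natCast_atTop_atTop
      exact (((hl.comp c1).mul (hinv.comp c2)).mul (hinv.comp c3)).mul_const _)
    (Filter.Eventually.of_forall fun m k => by
      rw [norm_mul, norm_mul, norm_mul]
      have hB0 : 0 ≤ B := (norm_nonneg _).trans (hB 0)
      gcongr
      exacts [hB _, hB'' _, hB'' _])
  simp only [(hasSum_finite_tripleProduct hp hp0 hz _).tsum_eq, mul_inv_cancel₀ hl0, one_mul,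
    tsum_mul_left] at lim
  exact tendsto_nhds_unique (ellTheta_multipliable hp z).hasProd.tendsto_prod_nat lim

/-- Nome zero is treated separately because the series uses negative powers of `p`; since `0 ^ 0 =
1`, the factor `j = 0` still contributes `1 - z`. -/
theorem ellTheta_zero_nome (z : ℂ) : ellTheta 0 z = 1 - z := by
  rw [ellTheta, tprod_eq_mulSingle 0 fun j hj => by simp [hj]]
  simp

/-- The substitution `k ↦ 1 - k` fixes `k (k - 1) / 2` and changes the sign of the theta
coefficient. -/
theorem ellTheta_inv (hp : ‖p‖ < 1) {z : ℂ} (hz : z ≠ 0) :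
    ellTheta p z⁻¹ = -(z⁻¹ * ellTheta p z) := by
  rcases eq_or_ne p 0 with rfl | hp0
  · rw [ellTheta_zero_nome, ellTheta_zero_nome]
    field_simp
    ring
  · obtain ⟨c, hc⟩ := exists_ellTheta_eq_tsum hp hp0
    rw [hc _ (inv_ne_zero hz), hc _ hz, ← (Equiv.subLeft (1 : ℤ)).tsum_eq]
    have : ∀ k : ℤ, thetaCoeff p (Equiv.subLeft 1 k) * z⁻¹ ^ (Equiv.subLeft 1 k) =
        -z⁻¹ * (thetaCoeff p k * z ^ k) := fun k => by
      have hk : ((-1 : ℂ) ^ k)⁻¹ = (-1) ^ k := by rw [← inv_zpow]; norm_num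
      rw [Equiv.subLeft_apply, thetaCoeff, thetaCoeff,
        show (1 - k) * (1 - k - 1) = k * (k - 1) by ring, zpow_sub₀ (by norm_num),
        zpow_sub₀ (inv_ne_zero hz), inv_zpow, div_eq_mul_inv, hk]
      simp
      ring
    simp only [this, tsum_mul_left]
    ring

/-- An absolutely convergent product vanishes only if a factor does, so a zero has `exp u` among the
`p ^ (-j)` or `p ^ (j + 1)`; fibres of `exp` are countable. -/
theorem countable_zeros_ellTheta (hp : ‖p‖ < 1) : {u : ℂ | ellTheta p (Complex.exp u) = 0}.Countable := by
  have hcount : (Set.range (fun j : ℕ => (p ^ j)⁻¹) ∪ Set.range fun j : ℕ => p ^ (j + 1)).Countable :=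
    (Set.countable_range _).union (Set.countable_range _)
  have hfib : ∀ w : ℂ, {u : ℂ | Complex.exp u = w}.Countable := fun w => by
    by_cases h : ∃ u, Complex.exp u = w
    · obtain ⟨u, rfl⟩ := h
      refine (Set.countable_range fun k : ℤ => u + k * (2 * Real.pi * Complex.I)).mono fun v hv => ?_
      obtain ⟨k, hk⟩ := Complex.exp_eq_exp_iff_exists_int.1 hv
      exact ⟨k, hk.symm⟩
    · push Not at h
      simp [h]
  refine (hcount.biUnion fun w _ => hfib w).mono fun u hu => ?_
  have hu : ellTheta p (Complex.exp u) = 0 := hu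
  have hz := Complex.exp_ne_zero u
  set z := Complex.exp u
  have hf : Summable fun j : ℕ => ‖(1 - p ^ j * z) * (1 - p ^ (j + 1) / z) - 1‖ := by
    have hg := summable_geometric_of_lt_one (norm_nonneg p) hp
    refine Summable.of_nonneg_of_le (fun _ => norm_nonneg _) (fun j => ?_)
      (hg.mul_right (‖z‖ + ‖p / z‖ + ‖p‖))
    have h1 : ‖p ^ (j + 1)‖ ≤ ‖p‖ := by
      rw [norm_pow]
      exact pow_le_of_le_one (norm_nonneg p) hp.le (by omega)
    rw [show (1 - p ^ j * z) * (1 - p ^ (j + 1) / z) - 1 =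
      p ^ j * (-z + -(p / z) + p ^ (j + 1)) by field_simp; ring, norm_mul, norm_pow]
    gcongr
    refine (norm_add₃_le).trans ?_
    rw [norm_neg, norm_neg]
    gcongr
  by_contra hcon
  refine tprod_one_add_ne_zero_of_summable (fun j hj => hcon ?_) hf (by
    simpa [ellTheta] using hu)
  rw [add_sub_cancel] at hj
  simp only [Set.mem_iUnion]
  rcases mul_eq_zero.1 hj with h | h
  · refine ⟨_, Or.inl ⟨j, rfl⟩, ?_⟩
    exact eq_inv_of_mul_eq_one_right (sub_eq_zero.1 h).symm
  · refine ⟨_, Or.inr ⟨j, rfl⟩, ?_⟩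
    exact (div_eq_one_iff_eq hz).1 (sub_eq_zero.1 h).symm |>.symm

end

/-! ### The Weierstrass addition formula for theta. -/

/-- The odd entire function `u ↦ exp (-u / 2) θ (exp u)`. -/
noncomputable def ellSigma (p u : ℂ) : ℂ :=
  Complex.exp (-u / 2) * ellTheta p (Complex.exp u)

/-- Splitting a double series according to the parity of the sum of the indices. -/
theorem tsum_int_prod_parity {f : ℤ × ℤ → ℂ} (hf : Summable f) :
    ∑' z, f z = (∑' s : ℤ, ∑' r : ℤ, f (s + r, s - r)) +
      ∑' s : ℤ, ∑' r : ℤ, f (s + r + 1, s - r) := by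
  let e₀ : ℤ × ℤ → ℤ × ℤ := fun z => (z.1 + z.2, z.1 - z.2)
  let e₁ : ℤ × ℤ → ℤ × ℤ := fun z => (z.1 + z.2 + 1, z.1 - z.2)
  have i₀ : Function.Injective e₀ := fun z w h => by
    simp only [e₀, Prod.mk.injEq] at h
    exact Prod.ext (by omega) (by omega)
  have i₁ : Function.Injective e₁ := fun z w h => by
    simp only [e₁, Prod.mk.injEq] at h
    exact Prod.ext (by omega) (by omega)
  have compl : (Set.range e₀)ᶜ = Set.range e₁ := by
    ext ⟨m, n⟩
    simp only [Set.mem_compl_iff, Set.mem_range, e₀, e₁, Prod.exists, Prod.mk.injEq, not_exists]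
    constructor
    · intro h
      refine ⟨(m + n - 1) / 2, (m - n - 1) / 2, ?_, ?_⟩ <;>
        have := h ((m + n) / 2) ((m - n) / 2) <;> omega
    · rintro ⟨a, b, h1, h2⟩ a' b' ⟨h3, h4⟩
      omega
  have split : ∑' x : Set.range e₀, f x + ∑' x : ↑(Set.range e₀)ᶜ, f x = ∑' z, f z :=
    (hf.subtype (Set.range e₀)).tsum_add_tsum_compl (hf.subtype (Set.range e₀)ᶜ)
  rw [compl, tsum_range f i₀, tsum_range f i₁] at split
  have h0 : Summable fun z => f (e₀ z) := hf.comp_injective i₀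
  have h1 : Summable fun z => f (e₁ z) := hf.comp_injective i₁
  rw [← split, h0.tsum_prod, h1.tsum_prod]

section

variable {p : ℂ}

theorem neg_one_zpow_mul (s r : ℤ) : (-1 : ℂ) ^ (s + r) * (-1) ^ (s - r) = 1 := by
  rw [← zpow_add₀ (by norm_num), show s + r + (s - r) = s + s by ring,
    zpow_add₀ (by norm_num), ← mul_zpow]
  norm_num

theorem mul_rearrange {K : Type*} [Field K] (a b c d a' b' c' d' : K) :
    a * b * (c * d) * (a' * b' * (c' / d')) = a * a' * (b * b') * (c * c') * (d / d') := by
  ring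

/-- For indices `s + r` and `s - r` the triangular exponents add up to `(s² - s) + r²`, separating
`x` from `y`. Index pairs of odd sum separate likewise below. -/
theorem thetaCoeff_even (hp0 : p ≠ 0) {x y : ℂ} (hx : x ≠ 0) (hy : y ≠ 0) (s r : ℤ) :
    thetaCoeff p (s + r) * (x * y) ^ (s + r) * (thetaCoeff p (s - r) * (x / y) ^ (s - r)) =
      (p ^ (s * s - s) * x ^ (2 * s)) * (p ^ (r * r) * y ^ (2 * r)) := by
  have e : (s + r) * (s + r - 1) / 2 + (s - r) * (s - r - 1) / 2 = s * s - s + r * r := by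
    have h1 := two_mul_triangle (s + r)
    have h2 := two_mul_triangle (s - r)
    linarith
  simp only [thetaCoeff, mul_zpow, div_zpow]
  calc _ = ((-1) ^ (s + r) * (-1) ^ (s - r)) *
        (p ^ ((s + r) * (s + r - 1) / 2) * p ^ ((s - r) * (s - r - 1) / 2)) *
        (x ^ (s + r) * x ^ (s - r)) * (y ^ (s + r) / y ^ (s - r)) := by
        exact mul_rearrange _ _ _ _ _ _ _ _
    _ = _ := by
      rw [neg_one_zpow_mul, ← zpow_add₀ hp0, e, ← zpow_add₀ hx, ← zpow_sub₀ hy,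
        zpow_add₀ hp0 (s * s - s), show s + r + (s - r) = 2 * s by ring,
        show s + r - (s - r) = 2 * r by ring, one_mul]
      ac_rfl

theorem thetaCoeff_odd (hp0 : p ≠ 0) {x y : ℂ} (hx : x ≠ 0) (hy : y ≠ 0) (s r : ℤ) :
    thetaCoeff p (s + r + 1) * (x * y) ^ (s + r + 1) *
        (thetaCoeff p (s - r) * (x / y) ^ (s - r)) =
      (p ^ (s * s) * x ^ (2 * s + 1)) * -(p ^ (r * r + r) * y ^ (2 * r + 1)) := by
  have e : (s + r + 1) * (s + r + 1 - 1) / 2 + (s - r) * (s - r - 1) / 2 =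
      s * s + (r * r + r) := by
    have h1 := two_mul_triangle (s + r + 1)
    have h2 := two_mul_triangle (s - r)
    linarith
  simp only [thetaCoeff, mul_zpow, div_zpow]
  calc _ = ((-1) ^ (s + r + 1) * (-1) ^ (s - r)) *
        (p ^ ((s + r + 1) * (s + r + 1 - 1) / 2) * p ^ ((s - r) * (s - r - 1) / 2)) *
        (x ^ (s + r + 1) * x ^ (s - r)) * (y ^ (s + r + 1) / y ^ (s - r)) := by
        exact mul_rearrange _ _ _ _ _ _ _ _
    _ = _ := by
      rw [zpow_add₀ (by norm_num : (-1 : ℂ) ≠ 0) (s + r) 1, zpow_one, mul_right_comm _ (-1 : ℂ),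
        neg_one_zpow_mul, ← zpow_add₀ hp0, e, ← zpow_add₀ hx, ← zpow_sub₀ hy,
        zpow_add₀ hp0 (s * s), show s + r + 1 + (s - r) = 2 * s + 1 by ring,
        show s + r + 1 - (s - r) = 2 * r + 1 by ring, one_mul, neg_one_mul, mul_neg]
      simp only [neg_mul]
      congr 1
      ac_rfl

/-- The products `θ(xy) θ(x/y)` span a space of rank at most two. -/
theorem exists_rank_two (hp : ‖p‖ < 1) :
    ∃ f₁ f₂ g₁ g₂ : ℂ → ℂ, ∀ x y : ℂ, x ≠ 0 → y ≠ 0 →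
      ellTheta p (x * y) * ellTheta p (x / y) = f₁ x * g₁ y + f₂ x * g₂ y := by
  rcases eq_or_ne p 0 with rfl | hp0
  · refine ⟨fun x => 1 + x ^ 2, fun x => x, fun _ => 1, fun y => -(y + y⁻¹), fun x y hx hy => ?_⟩
    rw [ellTheta_zero_nome, ellTheta_zero_nome]
    field_simp
    ring
  obtain ⟨c, hc⟩ := exists_ellTheta_eq_tsum hp hp0
  refine ⟨fun x => c * c * ∑' k : ℤ, p ^ (k * k - k) * x ^ (2 * k),
    fun x => c * c * ∑' k : ℤ, p ^ (k * k) * x ^ (2 * k + 1),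
    fun y => ∑' k : ℤ, p ^ (k * k) * y ^ (2 * k),
    fun y => ∑' k : ℤ, -(p ^ (k * k + k) * y ^ (2 * k + 1)), fun x y hx hy => ?_⟩
  have s1 := summable_norm_thetaCoeff hp hp0 (mul_ne_zero hx hy)
  have s2 := summable_norm_thetaCoeff hp hp0 (div_ne_zero hx hy)
  have hprod := tsum_mul_tsum_of_summable_norm s1 s2
  rw [tsum_int_prod_parity (summable_mul_of_summable_norm s1 s2)] at hprod
  simp only [thetaCoeff_even hp0 hx hy, thetaCoeff_odd hp0 hx hy, tsum_mul_left,
    tsum_mul_right] at hprod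
  rw [hc _ (mul_ne_zero hx hy), hc _ (div_ne_zero hx hy)]
  linear_combination c * c * hprod

/-- The 3 × 3 minor on rows `a, b, c` and columns `a, b, d` vanishes and equals, up to sign, `M a b`
times the Pfaffian. By symmetry a nonzero Pfaffian would force `M a b = M a c = M a d = 0`, and then
it would vanish. -/
theorem antisymm_rank_two_pfaffian {ι K : Type*} [Field K] {M : ι → ι → K} {f₁ f₂ g₁ g₂ : ι → K}
    (h0 : ∀ x, M x x = 0) (hM : ∀ x y, M y x = -M x y)
    (h : ∀ x y, M x y = f₁ x * g₁ y + f₂ x * g₂ y) (a b c d : ι) :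
    M a b * M c d - M a c * M b d + M a d * M b c = 0 := by
  have minor : ∀ a b c d, M a b * (M a b * M c d - M a c * M b d + M a d * M b c) = 0 := by
    intro a b c d
    have h1 : M a a * (M b b * M c d - M b d * M c b) - M a b * (M b a * M c d - M b d * M c a) +
        M a d * (M b a * M c b - M b b * M c a) = 0 := by
      simp only [h]
      ring
    rw [h0, h0, hM a b, hM a c, hM b c] at h1
    linear_combination h1
  by_contra hne
  have hab : M a b = 0 := (mul_eq_zero.1 (minor a b c d)).resolve_right hne
  have hac : M a c = 0 := (mul_eq_zero.1 (minor a c b d)).resolve_right fun h => hne (by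
    rw [hM b c] at h
    linear_combination -h)
  have had : M a d = 0 := (mul_eq_zero.1 (minor a d b c)).resolve_right fun h => hne (by
    rw [hM c d, hM b d] at h
    linear_combination h)
  exact hne (by rw [hab, hac, had]; ring)

theorem ellSigma_neg (hp : ‖p‖ < 1) (u : ℂ) : ellSigma p (-u) = -ellSigma p u := by
  rw [ellSigma, ellSigma, Complex.exp_neg, ellTheta_inv hp (Complex.exp_ne_zero u),
    ← Complex.exp_neg, mul_neg, ← mul_assoc, ← Complex.exp_add]
  congr 3
  ring

/-- The bracket is an antisymmetric kernel of rank at most two, the factor `exp (-x)` being absorbed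
into `f₁` and `f₂`; its vanishing Pfaffian is the addition formula. -/
theorem isWeierstrassSigma_ellSigma (hp : ‖p‖ < 1) : IsWeierstrassSigma (ellSigma p) := by
  obtain ⟨f₁, f₂, g₁, g₂, h⟩ := exists_rank_two hp
  have odd := ellSigma_neg hp
  have h00 : ellSigma p 0 = 0 := by
    have := odd 0
    rw [neg_zero] at this
    linear_combination this / 2
  refine ⟨odd, fun x y u v => ?_⟩
  have key := antisymm_rank_two_pfaffian
    (M := fun x y : ℂ => ellSigma p (x + y) * ellSigma p (x - y))
    (f₁ := fun x => Complex.exp (-x) * f₁ (Complex.exp x))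
    (f₂ := fun x => Complex.exp (-x) * f₂ (Complex.exp x))
    (g₁ := fun y => g₁ (Complex.exp y)) (g₂ := fun y => g₂ (Complex.exp y))
    (fun x => by simp [h00])
    (fun x y => by
      rw [show y - x = -(x - y) by ring, odd, add_comm y x, mul_neg])
    (fun x y => by
      have e : Complex.exp (-x) = Complex.exp (-(x + y) / 2) * Complex.exp (-(x - y) / 2) := by
        rw [← Complex.exp_add]
        congr 1
        ring
      rw [ellSigma, ellSigma, mul_mul_mul_comm, ← e, Complex.exp_add, Complex.exp_sub,
        h _ _ (Complex.exp_ne_zero x) (Complex.exp_ne_zero y)]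
      ring) x y u v
  rw [add_comm y u, show y - u = -(u - y) by ring, odd] at key
  linear_combination key

theorem countable_zeros_ellSigma (hp : ‖p‖ < 1) : {u | ellSigma p u = 0}.Countable := by
  refine (countable_zeros_ellTheta hp).mono fun u hu => ?_
  exact (mul_eq_zero.1 hu).resolve_left (Complex.exp_ne_zero _)

theorem continuous_ellSigma (hp : ‖p‖ < 1) : Continuous (ellSigma p) := by
  have exp_half : Continuous fun u : ℂ => Complex.exp (-u / 2) := by fun_prop
  refine exp_half.mul ?_
  rcases eq_or_ne p 0 with rfl | hp0
  · simp only [ellTheta_zero_nome]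
    fun_prop
  obtain ⟨c, hc⟩ := exists_ellTheta_eq_tsum hp hp0
  have e : (fun u => ellTheta p (Complex.exp u)) =
      fun u => c * ∑' k : ℤ, thetaCoeff p k * Complex.exp u ^ k :=
    funext fun u => hc _ (Complex.exp_ne_zero u)
  rw [e]
  refine continuous_const.mul (continuous_iff_continuousAt.2 fun u₀ => ?_)
  -- On the strip `|re u| < R` each term is dominated by the sum of its norms at `R` and `-R`, one
  -- for each sign of `k`.
  obtain ⟨R, hR⟩ := exists_gt |u₀.re|
  have hopen : IsOpen {u : ℂ | |u.re| < R} := isOpen_lt (by fun_prop) continuous_const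
  refine ContinuousOn.continuousAt (s := {u : ℂ | |u.re| < R}) ?_ (hopen.mem_nhds hR)
  refine continuousOn_tsum (fun k => ?_)
    ((summable_norm_thetaCoeff hp hp0 (Complex.exp_ne_zero R)).add
      (summable_norm_thetaCoeff hp hp0 (Complex.exp_ne_zero (-R : ℝ)))) (fun k u hu => ?_)
  · simp only [← Complex.exp_int_mul]
    fun_prop
  · have hu : |u.re| < R := hu
    simp only [← Complex.exp_int_mul, norm_mul, Complex.norm_exp, ← mul_add]
    refine mul_le_mul_of_nonneg_left ?_ (norm_nonneg _)
    have hre : ∀ v : ℂ, ((k : ℂ) * v).re = k * v.re := fun v => by simp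
    rw [hre, hre, hre, Complex.ofReal_re, Complex.ofReal_re]
    have hu' := abs_lt.1 hu
    rcases le_total 0 (k : ℝ) with hk | hk
    · exact (Real.exp_le_exp.2 (mul_le_mul_of_nonneg_left hu'.2.le hk)).trans
        (le_add_of_nonneg_right (Real.exp_pos _).le)
    · exact (Real.exp_le_exp.2 (mul_le_mul_of_nonpos_left hu'.1.le hk)).trans
        (le_add_of_nonneg_left (Real.exp_pos _).le)

end

/-! ### Return to multiplicative notation. -/

theorem ellTheta_eq_ellSigma {p z u : ℂ} (h : z = Complex.exp u) :
    ellTheta p z = Complex.exp (u / 2) * ellSigma p u := by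
  rw [ellSigma, ← mul_assoc, ← Complex.exp_add, h]
  simp [neg_div]

theorem ellPoch_eq_sigmaPoch {p q z η u : ℂ} (hq : q = Complex.exp η) (h : z = Complex.exp u)
    (k : ℕ) : ellPoch p q z k =
      Complex.exp ((k * u + k * (k - 1) / 2 * η) / 2) * sigmaPoch (ellSigma p) η u k := by
  induction k with
  | zero => simp [ellPoch]
  | succ k ih =>
    rw [ellPoch] at ih ⊢
    rw [Finset.prod_range_succ, ih, sigmaPoch_succ, ellTheta_eq_ellSigma (u := u + k * η) (by
      rw [h, hq, Complex.exp_add, Complex.exp_nat_mul]), mul_mul_mul_comm, ← Complex.exp_add]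
    congr 2
    push_cast
    ring

/-- Balancing collapses the half-argument exponentials to one factor, which cancels the dependence
on `x` of the exponential in `thetaVandermondeSq_eq`. -/
theorem vwpWeight_eq_sigmaWeight {p q a b c d e η α β γ δ ε : ℂ} {n N : ℕ}
    (hq : q = Complex.exp η) (ha : a = Complex.exp α) (hb : b = Complex.exp β)
    (hc : c = Complex.exp γ) (hd : d = Complex.exp δ) (he : e = Complex.exp ε)
    (hbal : β + γ + δ + ε = (N + 3 - 2 * n) * η + 2 * α) (y : ℕ) :
    vwpWeight p q a b c d e N y = Complex.exp (-(2 * (n - 1) * (y * η))) *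
      sigmaWeight (ellSigma p) η α β γ δ ε (-N * η) y := by
  have quot : ∀ {z u : ℂ}, z = Complex.exp u → a * q / z = Complex.exp (α + η - u) :=
    fun h => by rw [Complex.exp_sub, Complex.exp_add, ha, hq, h]
  have hN : q ^ (-(N : ℤ)) = Complex.exp (-N * η) := by
    rw [hq, ← Complex.exp_int_mul]
    congr 1
    push_cast
    ring
  have haN : a * q ^ (N + 1) = Complex.exp (α + η - -N * η) := by
    rw [ha, hq, ← Complex.exp_nat_mul, ← Complex.exp_add]
    congr 1
    push_cast
    ring
  simp only [vwpWeight, ellPochs, List.map_cons, List.map_nil, List.prod_cons, List.prod_nil]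
  rw [ellTheta_eq_ellSigma (z := a * q ^ (2 * y)) (u := α + 2 * y * η) (by
      rw [ha, hq, ← Complex.exp_nat_mul, ← Complex.exp_add]; push_cast; rfl),
    ellTheta_eq_ellSigma ha, ellPoch_eq_sigmaPoch hq ha, ellPoch_eq_sigmaPoch hq hb,
    ellPoch_eq_sigmaPoch hq hc, ellPoch_eq_sigmaPoch hq hd, ellPoch_eq_sigmaPoch hq he,
    ellPoch_eq_sigmaPoch hq hN, ellPoch_eq_sigmaPoch hq hq, ellPoch_eq_sigmaPoch hq (quot hb),
    ellPoch_eq_sigmaPoch hq (quot hc), ellPoch_eq_sigmaPoch hq (quot hd),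
    ellPoch_eq_sigmaPoch hq (quot he), ellPoch_eq_sigmaPoch hq haN, hq, ← Complex.exp_nat_mul,
    sigmaWeight]
  have merge : ∀ t0 t1 u0 u1 u2 u3 u4 u5 v0 v1 v2 v3 v4 v5 w T0 T1 U0 U1 U2 U3 U4 U5
      V0 V1 V2 V3 V4 V5 r : ℂ,
      t0 - t1 + (u0 + u1 + u2 + u3 + u4 + u5) - (v0 + v1 + v2 + v3 + v4 + v5) + w = r →
      Complex.exp t0 * T0 / (Complex.exp t1 * T1) *
        ((Complex.exp u0 * U0 * (Complex.exp u1 * U1 * (Complex.exp u2 * U2 *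
          (Complex.exp u3 * U3 * (Complex.exp u4 * U4 * (Complex.exp u5 * U5 * 1)))))) /
        (Complex.exp v0 * V0 * (Complex.exp v1 * V1 * (Complex.exp v2 * V2 *
          (Complex.exp v3 * V3 * (Complex.exp v4 * V4 * (Complex.exp v5 * V5 * 1))))))) *
        Complex.exp w =
      Complex.exp r * (T0 / T1 * ((U0 * U1 * U2 * U3 * U4 * U5) /
        (V0 * V1 * V2 * V3 * V4 * V5))) := by
    intros
    rename_i h
    rw [← h]
    simp only [Complex.exp_add, Complex.exp_sub]
    ring
  refine merge _ _ _ _ _ _ _ _ _ _ _ _ _ _ _ _ _ _ _ _ _ _ _ _ _ _ _ _ _ _ ?_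
  linear_combination y * hbal

theorem sum_pairs {n : ℕ} (f : Fin n → ℂ) :
    ∑ i : Fin n, ∑ j ∈ Finset.Ioi i, (f i + f j) = (n - 1) * ∑ i, f i := by
  simp only [Finset.sum_add_distrib]
  rw [Finset.sum_comm' (f := fun _ j => f j) (s := Finset.univ) (t := fun i : Fin n => Finset.Ioi i)
    (t' := Finset.univ) (s' := fun j : Fin n => Finset.Iio j) (fun x y => by simp),
    ← Finset.sum_add_distrib, Finset.mul_sum]
  refine Finset.sum_congr rfl fun i _ => ?_
  rw [Finset.sum_const, Finset.sum_const, Fin.card_Ioi, Fin.card_Iio, nsmul_eq_mul, nsmul_eq_mul,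
    ← add_mul, ← Nat.cast_add, show n - 1 - i + i = n - 1 by omega, Nat.cast_sub (by have := i.2; omega)]
  simp

/-- The prefactor `q ^ x_i` makes the exponent of each pair symmetric, namely `α + 2 (x_i + x_j) η`,
so the total is a sum over single indices, each lying in `n - 1` pairs. -/
theorem thetaVandermondeSq_eq {p q a η α : ℂ} {n N : ℕ} (hq : q = Complex.exp η)
    (ha : a = Complex.exp α) (x : Fin n → Fin (N + 1)) :
    thetaVandermondeSq p q a x =
      Complex.exp ((n - 1) * ∑ i, (α / 2 + 2 * ((x i : ℕ) * η))) *
      ∏ i : Fin n, ∏ j ∈ Finset.Ioi i, (ellSigma p (((x j : ℕ) - (x i : ℕ)) * η) *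
        ellSigma p (α + ((x i : ℕ) + (x j : ℕ)) * η)) ^ 2 := by
  rw [← sum_pairs, Complex.exp_sum, thetaVandermondeSq, ← Finset.prod_mul_distrib]
  refine Finset.prod_congr rfl fun i _ => ?_
  rw [Complex.exp_sum, ← Finset.prod_mul_distrib]
  refine Finset.prod_congr rfl fun j _ => ?_
  rw [ellTheta_eq_ellSigma (u := ((x j : ℕ) - (x i : ℕ)) * η) (by
      rw [hq, ← Complex.exp_int_mul]; push_cast; rfl),
    ellTheta_eq_ellSigma (u := α + ((x i : ℕ) + (x j : ℕ)) * η) (by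
      rw [ha, hq, ← Complex.exp_nat_mul, ← Complex.exp_add]; push_cast; rfl),
    hq, ← Complex.exp_nat_mul]
  have merge : ∀ t u v T U : ℂ, (Complex.exp t * (Complex.exp u * T) * (Complex.exp v * U)) ^ 2 =
      Complex.exp (2 * (t + u + v)) * (T * U) ^ 2 := fun t u v T U => by
    rw [two_mul (t + u + v)]
    simp only [Complex.exp_add]
    ring
  rw [merge]
  congr 2
  ring

theorem sum_range_quadratic (A B C : ℂ) (n : ℕ) :
    ∑ j ∈ Finset.range n, (A + B * j + C * (j * j)) =
      A * n + B * (n * (n - 1) / 2) + C * (n * (n - 1) * (2 * n - 1) / 6) := by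
  induction n with
  | zero => simp
  | succ n ih =>
    rw [Finset.sum_range_succ, ih]
    push_cast
    ring

theorem mainTheorem3 (p q a b c d e : ℂ) (n N : ℕ) (hn : n ≤ N + 1)
    (hp : ‖p‖ < 1) (hq : ‖q‖ < 1) (hq0 : q ≠ 0) (ha0 : a ≠ 0)
    (hbal : b * c * d * e = q ^ ((N : ℤ) + 3 - 2 * n) * a ^ 2)
    (hθa : ellTheta p a ≠ 0)
    (hden : ellPochs p q
      [q, a * q / b, a * q / c, a * q / d, a * q / e, a * q ^ (N + 1)] N ≠ 0) :
    ∑ x ∈ increasingTuples n N,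
        thetaVandermondeSq p q a x * ∏ j : Fin n, vwpWeight p q a b c d e N (x j) =
      b ^ (n * (N + 1 - n)) *
        q ^ ((n : ℤ) * (n - 1) * (3 * N + 1 - 2 * n) / 3 + (n.choose 2 : ℤ)) *
        ellPoch p q (a * q) N ^ n *
        ∏ j ∈ Finset.Icc 1 n,
          ellPochs p q [q, b, c, d, e, q ^ (-(N : ℤ))] (j - 1) *
            ellPochs p q
              [a * q ^ (2 - (j : ℤ)) / (b * c), a * q ^ (2 - (j : ℤ)) / (b * d),
                a * q ^ (2 - (j : ℤ)) / (b * e)] (N + 1 - n) /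
            ellPochs p q [a * q / b, a * q / c, a * q / d, a * q / e] (N + 1 - j) := by
  have ha2 : q ^ ((N : ℤ) + 3 - 2 * n) * a ^ 2 ≠ 0 :=
    mul_ne_zero (zpow_ne_zero _ hq0) (pow_ne_zero 2 ha0)
  rw [← hbal] at ha2
  have he0 := right_ne_zero_of_mul ha2
  have hd0 := right_ne_zero_of_mul (left_ne_zero_of_mul ha2)
  have hc0 := right_ne_zero_of_mul (left_ne_zero_of_mul (left_ne_zero_of_mul ha2))
  have hb0 := left_ne_zero_of_mul (left_ne_zero_of_mul (left_ne_zero_of_mul ha2))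
  obtain ⟨η, hη⟩ : ∃ η, q = Complex.exp η := ⟨_, (Complex.exp_log hq0).symm⟩
  obtain ⟨α, hα⟩ : ∃ α, a = Complex.exp α := ⟨_, (Complex.exp_log ha0).symm⟩
  obtain ⟨β, hβ⟩ : ∃ β, b = Complex.exp β := ⟨_, (Complex.exp_log hb0).symm⟩
  obtain ⟨γ, hγ⟩ : ∃ γ, c = Complex.exp γ := ⟨_, (Complex.exp_log hc0).symm⟩
  obtain ⟨δ, hδ⟩ : ∃ δ, d = Complex.exp δ := ⟨_, (Complex.exp_log hd0).symm⟩
  -- Choosing logarithms of all five parameters would give balancing only modulo `2πi`. Here `ε` is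
  -- defined by the additive condition, and `e = exp ε` is deduced.
  obtain ⟨ε, hsum⟩ : ∃ ε, β + γ + δ + ε = (N + 3 - 2 * n) * η + 2 * α :=
    ⟨(N + 3 - 2 * n) * η + 2 * α - (β + γ + δ), by ring⟩
  have hε : e = Complex.exp ε := by
    refine mul_left_cancel₀ (left_ne_zero_of_mul ha2) (hbal.trans ?_)
    rw [hη, hα, hβ, hγ, hδ, ← Complex.exp_add, ← Complex.exp_add, ← Complex.exp_add, hsum,
      Complex.exp_add, ← Complex.exp_int_mul, ← Complex.exp_nat_mul]
    push_cast
    rfl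
  have quot : ∀ {z u : ℂ}, z = Complex.exp u → a * q / z = Complex.exp (α + η - u) :=
    fun h => by rw [Complex.exp_sub, Complex.exp_add, hα, hη, h]
  have hN : q ^ (-(N : ℤ)) = Complex.exp (-N * η) := by
    rw [hη, ← Complex.exp_int_mul]
    congr 1
    push_cast
    ring
  have haN : a * q ^ (N + 1) = Complex.exp (α + η - -N * η) := by
    rw [hα, hη, ← Complex.exp_nat_mul, ← Complex.exp_add]
    congr 1
    push_cast
    ring
  have haq : a * q = Complex.exp (α + η) := by rw [hα, hη, Complex.exp_add]
  have ratio : ∀ {z u : ℂ} (j : ℕ), z = Complex.exp u →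
      a * q ^ (2 - ((j + 1 : ℕ) : ℤ)) / (b * z) = Complex.exp (α + η - β - u - j * η) := by
    intro z u j h
    rw [hα, hη, hβ, h, ← Complex.exp_int_mul, ← Complex.exp_add, ← Complex.exp_add,
      ← Complex.exp_sub]
    congr 1
    push_cast
    ring
  have hσ := isWeierstrassSigma_ellSigma hp
  rw [ellTheta_eq_ellSigma hα] at hθa
  simp only [ellPochs, List.map_cons, List.map_nil, List.prod_cons, List.prod_nil, mul_one,
    mul_ne_zero_iff, ellPoch_eq_sigmaPoch hη hη, ellPoch_eq_sigmaPoch hη (quot hβ),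
    ellPoch_eq_sigmaPoch hη (quot hγ), ellPoch_eq_sigmaPoch hη (quot hδ),
    ellPoch_eq_sigmaPoch hη (quot hε), ellPoch_eq_sigmaPoch hη haN] at hden
  obtain ⟨⟨_, n0⟩, ⟨_, n1⟩, ⟨_, n2⟩, ⟨_, n3⟩, ⟨_, n4⟩, ⟨_, n5⟩⟩ := hden
  have main := sigma_selberg hσ (continuous_ellSigma hp) (countable_zeros_ellSigma hp) hn hsum
    (right_ne_zero_of_mul hθa) n0 n1 n2 n3 n4 n5
  have lhs : ∀ x ∈ increasingTuples n N,
      thetaVandermondeSq p q a x * ∏ j : Fin n, vwpWeight p q a b c d e N (x j) =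
      Complex.exp (n * (n - 1) / 2 * α) * ((∏ i : Fin n, ∏ j ∈ Finset.Ioi i,
        (ellSigma p (((x j : ℕ) - (x i : ℕ)) * η) *
          ellSigma p (α + ((x i : ℕ) + (x j : ℕ)) * η)) ^ 2) *
        ∏ i : Fin n, sigmaWeight (ellSigma p) η α β γ δ ε (-N * η) (x i)) := fun x _ => by
    rw [thetaVandermondeSq_eq hη hα, Finset.prod_congr rfl fun j _ =>
      vwpWeight_eq_sigmaWeight hη hα hβ hγ hδ hε hsum (x j), Finset.prod_mul_distrib,
      ← Complex.exp_sum, mul_mul_mul_comm, ← Complex.exp_add]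
    congr 2
    rw [Finset.mul_sum, ← Finset.sum_add_distrib, Finset.sum_congr rfl (g := fun _ =>
      ((n : ℂ) - 1) / 2 * α) fun i _ => by ring]
    simp
    ring
  have shift : ∀ f : ℕ → ℂ, ∏ j ∈ Finset.Icc 1 n, f j = ∏ j ∈ Finset.range n, f (j + 1) := fun f => by
    rw [Finset.range_eq_Ico, Finset.prod_Ico_add' f 0 n 1, zero_add,
      Finset.Ico_add_one_right_eq_Icc]
  have merge : ∀ u0 u1 u2 u3 u4 u5 w0 w1 w2 v0 v1 v2 v3 U0 U1 U2 U3 U4 U5 W0 W1 W2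
      V0 V1 V2 V3 r : ℂ,
      u0 + u1 + u2 + u3 + u4 + u5 + (w0 + w1 + w2) - (v0 + v1 + v2 + v3) = r →
      Complex.exp u0 * U0 * (Complex.exp u1 * U1 * (Complex.exp u2 * U2 *
          (Complex.exp u3 * U3 * (Complex.exp u4 * U4 * (Complex.exp u5 * U5))))) *
        (Complex.exp w0 * W0 * (Complex.exp w1 * W1 * (Complex.exp w2 * W2))) /
        (Complex.exp v0 * V0 * (Complex.exp v1 * V1 * (Complex.exp v2 * V2 *
          (Complex.exp v3 * V3)))) =
      Complex.exp r * ((U0 * U1 * U2 * U3 * U4 * U5) * (W0 * W1 * W2) / (V0 * V1 * V2 * V3)) := by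
    intros
    rename_i h
    rw [← h]
    simp only [Complex.exp_add, Complex.exp_sub]
    ring
  have hM : ((N + 1 - n : ℕ) : ℂ) = N + 1 - n := by
    rw [Nat.cast_sub hn]
    push_cast
    rfl
  -- The exponent is arranged as a quadratic in `j`, with `γ, δ, ε` entering only through `β + γ + δ
  -- + ε`. After balancing, `β` is the only one of these four left, which is why `b` alone has a
  -- power in front.
  have factor : ∀ j ∈ Finset.range n,
      ellPochs p q [q, b, c, d, e, q ^ (-(N : ℤ))] (j + 1 - 1) *
        ellPochs p q [a * q ^ (2 - ((j + 1 : ℕ) : ℤ)) / (b * c),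
          a * q ^ (2 - ((j + 1 : ℕ) : ℤ)) / (b * d),
          a * q ^ (2 - ((j + 1 : ℕ) : ℤ)) / (b * e)] (N + 1 - n) /
        ellPochs p q [a * q / b, a * q / c, a * q / d, a * q / e] (N + 1 - (j + 1)) =
      Complex.exp
        (((N + 1 - n) * (3 * α + 3 * η - 2 * β - (β + γ + δ + ε)) +
            3 * ((N + 1 - n) * (N - n) / 2) * η - N * (4 * α + 4 * η - (β + γ + δ + ε)) -
            2 * (N * (N - 1)) * η) / 2 +
          (η - N * η - 3 * η - 3 * (N + 1 - n) * η + 4 * α + 4 * η + 2 * (2 * N - 1) * η) / 2 * j +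
          η / 2 * (j * j)) *
      ((sigmaPoch (ellSigma p) η η j * sigmaPoch (ellSigma p) η β j *
          sigmaPoch (ellSigma p) η γ j * sigmaPoch (ellSigma p) η δ j *
          sigmaPoch (ellSigma p) η ε j * sigmaPoch (ellSigma p) η (-N * η) j) *
        (sigmaPoch (ellSigma p) η (α + η - β - γ - j * η) (N + 1 - n) *
          sigmaPoch (ellSigma p) η (α + η - β - δ - j * η) (N + 1 - n) *
          sigmaPoch (ellSigma p) η (α + η - β - ε - j * η) (N + 1 - n)) /
        (sigmaPoch (ellSigma p) η (α + η - β) (N - j) *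
          sigmaPoch (ellSigma p) η (α + η - γ) (N - j) *
          sigmaPoch (ellSigma p) η (α + η - δ) (N - j) *
          sigmaPoch (ellSigma p) η (α + η - ε) (N - j))) := fun j hj => by
    have hj := Finset.mem_range.1 hj
    have hNj : ((N - j : ℕ) : ℂ) = N - j := Nat.cast_sub (by omega)
    simp only [ellPochs, List.map_cons, List.map_nil, List.prod_cons, List.prod_nil, mul_one,
      Nat.add_sub_cancel, Nat.add_sub_add_right]
    rw [ellPoch_eq_sigmaPoch hη hη, ellPoch_eq_sigmaPoch hη hβ, ellPoch_eq_sigmaPoch hη hγ,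
      ellPoch_eq_sigmaPoch hη hδ, ellPoch_eq_sigmaPoch hη hε, ellPoch_eq_sigmaPoch hη hN,
      ellPoch_eq_sigmaPoch hη (ratio j hγ), ellPoch_eq_sigmaPoch hη (ratio j hδ),
      ellPoch_eq_sigmaPoch hη (ratio j hε), ellPoch_eq_sigmaPoch hη (quot hβ),
      ellPoch_eq_sigmaPoch hη (quot hγ), ellPoch_eq_sigmaPoch hη (quot hδ),
      ellPoch_eq_sigmaPoch hη (quot hε)]
    refine merge _ _ _ _ _ _ _ _ _ _ _ _ _ _ _ _ _ _ _ _ _ _ _ _ _ _ _ ?_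
    rw [hM, hNj]
    ring
  -- Integer division by `3` commutes with the cast only because it is exact.
  have hexp : (((n : ℤ) * (n - 1) * (3 * N + 1 - 2 * n) / 3 + (n.choose 2 : ℤ) : ℤ) : ℂ) =
      n * (n - 1) * (3 * N + 1 - 2 * n) / 3 + n * (n - 1) / 2 := by
    rw [Int.cast_add, Int.cast_div (three_dvd_selbergExponent n N) (by norm_num), Int.cast_natCast,
      Nat.cast_choose_two]
    push_cast
    rfl
  rw [Finset.sum_congr rfl lhs, ← Finset.mul_sum, main, shift, Finset.prod_congr rfl factor,
    Finset.prod_mul_distrib, ← Complex.exp_sum, sum_range_quadratic, ellPoch_eq_sigmaPoch hη haq,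
    mul_pow, hη, hβ, ← Complex.exp_nat_mul, ← Complex.exp_nat_mul, ← Complex.exp_int_mul, hexp]
  have collect : ∀ u v w t r X Y : ℂ, u + v + w + t = r → Complex.exp r * (X * Y) =
      Complex.exp u * Complex.exp v * (Complex.exp w * X) * (Complex.exp t * Y) := by
    intros
    rename_i h
    rw [← h]
    simp only [Complex.exp_add]
    ring
  refine collect _ _ _ _ _ _ _ ?_
  push_cast
  rw [hM]
  rw [hsum]
  ring
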